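/- Notation. Let $(a)_n=a(a+1)\cdots(a+n-1)$, $(a)_0=1$, let $C_n^{\kappa}$ be the Gegenbauer polynomials, and for $\alpha\in\mathbb R$ let $$\Lambda=\Lambda(\alpha;x,y)=1+(x^2+y^2)\sinh^2\alpha-2xy\sinh\alpha\cosh\alpha ,$$ which is positive for $x,y\in[-1,1]$. Let $\sigma\in\mathbb C$, let $p,q\ge 2$ be integers and $\lambda,\mu\ge0$ integers. Define $P^{[p,q]}_{\sigma\lambda\mu}(\alpha)$ as follows. For $p,q\ge3$: $$P^{[p,q]}_{\sigma\lambda\mu}(\alpha)=a^{pq}_{\lambda\mu}\int_{-1}^{1}\!\int_{-1}^{1}\Lambda^{\sigma/2}\,C_\mu^{\frac{p-2}{2}}(x)\,C_\lambda^{\frac{q-2}{2}}(y)\,(1-x^2)^{\frac{p-3}{2}}(1-y^2)^{\frac{q-3}{2}}\,dx\,dy .$$ For $p\ge3$, $q=2$ (with $y=\cos\phi$): $$P^{[p,2]}_{\sigma\lambda\mu}(\alpha)=a^{p}_{\mu}\int_{-1}^{1}\!\int_{0}^{2\pi}\Lambda^{\sigma/2}\,C_\mu^{\frac{p-2}{2}}(x)\,e^{-i\lambda\phi}(1-x^2)^{\frac{p-3}{2}}\,d\phi\,dx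 .$$ For $p=2$, $q\ge3$ (with $x=\cos\chi$): $$P^{[2,q]}_{\sigma\lambda\mu}(\alpha)=a^{q}_{\lambda}\int_{-1}^{1}\!\int_{0}^{2\pi}\Lambda^{\sigma/2}\,C_\lambda^{\frac{q-2}{2}}(y)\,e^{-i\mu\chi}(1-y^2)^{\frac{q-3}{2}}\,d\chi\,dy .$$ For $p=q=2$ (with $x=\cos\chi$, $y=\cos\phi$): $$P^{[2,2]}_{\sigma\lambda\mu}(\alpha)=\frac1{4\pi^2}\int_0^{2\pi}\!\int_0^{2\pi}\Lambda^{\sigma/2}e^{-i(\lambda\phi+\mu\chi)}\,d\phi\,d\chi .$$ Here $$a^p_\mu=\Gamma\!\left(\tfrac{p-2}2\right)\sqrt{\frac{2^{p-6}\,\mu!\,(2\mu+p-2)\,\Gamma(\frac p2)}{\pi^{7/2}\,\Gamma(\mu+p-2)\,\Gamma(\frac{p-1}2)}},$$ $$a^{pq}_{\lambda\mu}=\Gamma\!\left(\tfrac{p-2}2\right)\Gamma\!\left(\tfrac{q-2}2\right)\sqrt{\frac{2^{p+q-8}\,\Gamma(\frac p2)\Gamma(\frac q2)}{\pi^3\,\Gamma(\frac{p-1}2)\Gamma(\frac{q-1}2)}}\sqrt{\frac{\lambda!\,\mu!\,(2\mu+p-2)(2\lambda+q-2)}{\Gamma(\lambda+q-2)\,\Gamma(\mu+p-2)}}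 .$$ For integers $r,s\ge0$ and $\nu\in\{0,1\}$ the associated spherical function of $SO_0(p,q)$ is $$\mathbb P^{pq\nu}_{\sigma rs}(\alpha)=P^{[p,q]}_{\sigma,\,\nu+2r,\,\nu+2s}(\alpha).$$ Let $$A_1^{pq}=\frac{2^{3-\frac{p+q}2-\nu}\,(-\sigma/2)_{s+r+\nu}}{\Gamma(2s+\nu+\frac p2)\,\Gamma(2r+\nu+\frac q2)}\sqrt{\frac{\pi\,\Gamma(\frac p2)\Gamma(\frac q2)}{\Gamma(\frac{p-1}2)\Gamma(\frac{q-1}2)}}\sqrt{\frac{\Gamma(2s+\nu+p-1)\,\Gamma(2r+\nu+q-1)}{(2s+\nu)!\,(2r+\nu)!}},$$ $$A_2^{pq}=\sqrt{\rho_p(2s+\nu)\,\rho_q(2r+\nu)},\qquad \rho_n(l)=\frac{l+\frac{n-2}2}{l+n-2}\ \ (n\ge3),\qquad \rho_2(l)=\tfrac12 .$$ Statement. Let $p,q\ge2$, $r,s\ge0$, $\nu\in\{0,1\}$, $\sigma\in\mathbb C$, $\alpha\in\mathbb R$. (i) If $s\ge r$, then $$\mathbb P^{pq\nu}_{\sigma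 rs}(\alpha)=\frac{(2s+\nu)!\,\left(\frac{2-\sigma-q}{2}\right)_{s-r}}{(s-r)!\,4^s\,\left(2r+\nu+\frac q2\right)_{s-r}}\,A_1^{pq}A_2^{pq}\,\frac{(\tanh\alpha)^{2s+\nu}}{\cosh\alpha}\;F ,$$ where $F$ is the absolutely convergent Horn series ${}_5F_3$ in the variables $(\tanh^2\alpha,\tanh^2\alpha)$: $$F=\sum_{m,n\ge0}\frac{(s+1)_{m+n}\left(s+\nu+\frac12\right)_{m+n}\left(s+r+\nu-\frac\sigma2\right)_m\left(\frac{q+\sigma}2\right)_n\left(s-r+\frac{p+\sigma}2\right)_n}{\left(2s+\nu+\frac p2\right)_{m+n}\left(s+r+\nu+\frac q2\right)_{m+n}(1+s-r)_n}\,\frac{(\tanh^2\alpha)^{m+n}}{m!\,n!}.$$ (ii) $\mathbb P^{pq\nu}_{\sigma rs}(\alpha)=\mathbb P^{qp\nu}_{\sigma sr}(\alpha)$. Hence, for $s\le r$, $\mathbb P^{pq\nu}_{\sigma rs}(\alpha)$ is given by the right-hand side of (i) after exchanging $p\leftrightarrow q$ and $r\leftrightarrow s$, and the series so obtained converges absolutely.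 (iii) Let the zonal function $Z_\sigma^{[p,q]}(\alpha)$ ($p\ge2$, $q\ge1$) be the mean value of $\Lambda^{\sigma/2}$ over $S^{p-1}\times S^{q-1}$, $x$ and $y$ being the first coordinates on the two unit spheres. Explicitly, $$Z^{[p,q]}_\sigma(\alpha)=\frac{\Gamma(\frac p2)\Gamma(\frac q2)}{\pi\,\Gamma(\frac{p-1}2)\Gamma(\frac{q-1}2)}\int_{-1}^1\!\int_{-1}^1\Lambda^{\sigma/2}(1-x^2)^{\frac{p-3}2}(1-y^2)^{\frac{q-3}2}\,dx\,dy\qquad(p,q\ge3);$$ if $p=2$ (or $q=2$) the mean over $x$ (or $y$) is $\frac1{2\pi}\int_0^{2\pi}d\chi$ with $x=\cos\chi$ (or $\frac1{2\pi}\int_0^{2\pi}d\phi$ with $y=\cos\phi$); if $q=1$, then $\Lambda^{\sigma/2}$ is replaced by $(\cosh\alpha-x\sinh\alpha)^\sigma$ and only the mean over $x$ is taken. For $p,q\ge2$ one has $Z_\sigma^{[p,q]}(\alpha)=\mathbb P^{pq0}_{\sigma00}(\alpha)$, and for $p\ge2$, $q\ge1$ $$Z_\sigma^{[p,q]}(\alpha)=\frac1{\cosh\alpha}\sum_{m,n\ge0}\frac{(1)_{m+n}\left(\frac12\right)_{m+n}\left(-\frac\sigma2\right)_m\left(\frac{q+\sigma}2\right)_n\left(\frac{p+\sigma}2\right)_n}{\left(\frac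 p2\right)_{m+n}\left(\frac q2\right)_{m+n}(1)_n}\,\frac{(\tanh^2\alpha)^{m+n}}{m!\,n!},$$ the series being absolutely convergent. -/

import Mathlib

noncomputable section

namespace SOpq

/-- The Pochhammer symbol `(a)_n = a (a + 1) ⋯ (a + n - 1)`, with `(a)_0 = 1`. -/
def poch (a : ℂ) (n : ℕ) : ℂ := (ascPochhammer ℂ n).eval a

/-- The general term, at the multi-index `n`, of the generalized hypergeometric Horn series in
`k` variables with numerator parameters `a` (exponent vectors `u`) and denominator parameters `b`
(exponent vectors `v`). -/
def hornTerm {k A B : ℕ} (u : Fin A → Fin k → ℕ) (a : Fin A → ℂ)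
    (v : Fin B → Fin k → ℕ) (b : Fin B → ℂ) (x : Fin k → ℂ) (n : Fin k → ℕ) : ℂ :=
  (∏ i, poch (a i) (∑ j, u i j * n j)) / (∏ i, poch (b i) (∑ j, v i j * n j)) *
    ∏ j, x j ^ n j / ((n j).factorial : ℂ)

/-- The sum of the generalized hypergeometric Horn series. -/
def hornSeries {k A B : ℕ} (u : Fin A → Fin k → ℕ) (a : Fin A → ℂ)
    (v : Fin B → Fin k → ℕ) (b : Fin B → ℂ) (x : Fin k → ℂ) : ℂ :=
  ∑' n : Fin k → ℕ, hornTerm u a v b x n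

/-- Exponent vectors `11, 11, 10, 01, 01` of the five numerator parameters. -/
def u5 : Fin 5 → Fin 2 → ℕ := ![![1, 1], ![1, 1], ![1, 0], ![0, 1], ![0, 1]]

/-- Exponent vectors `11, 11, 01` of the three denominator parameters. -/
def v3 : Fin 3 → Fin 2 → ℕ := ![![1, 1], ![1, 1], ![0, 1]]

/-- Numerator parameters of the `₅F₃` series of the associated functions. -/
def assocNum (p q ν : ℕ) (σ : ℂ) (r s : ℕ) : Fin 5 → ℂ :=
  ![(s : ℂ) + 1, (s : ℂ) + ν + 1 / 2, (s : ℂ) + r + ν - σ / 2,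
    ((q : ℂ) + σ) / 2, (s : ℂ) - r + ((p : ℂ) + σ) / 2]

/-- Denominator parameters of the `₅F₃` series of the associated functions. -/
def assocDen (p q ν r s : ℕ) : Fin 3 → ℂ :=
  ![2 * (s : ℂ) + ν + (p : ℂ) / 2, (s : ℂ) + r + ν + (q : ℂ) / 2, 1 + (s : ℂ) - r]

/-- The point `(tanh² α, tanh² α)`. -/
def tanhSq (α : ℝ) : Fin 2 → ℂ := ![((Real.tanh α ^ 2 : ℝ) : ℂ), ((Real.tanh α ^ 2 : ℝ) : ℂ)]

/-- The Gegenbauer polynomial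
`C_n^κ(x) = ∑_{k ≤ n/2} (-1)^k (κ)_{n-k} / (k! (n-2k)!) (2x)^{n-2k}`. -/
def gegenbauer (n : ℕ) (κ x : ℝ) : ℝ :=
  ∑ k ∈ Finset.range (n / 2 + 1),
    (-1) ^ k * (ascPochhammer ℝ (n - k)).eval κ /
      ((k.factorial : ℝ) * ((n - 2 * k).factorial : ℝ)) * (2 * x) ^ (n - 2 * k)

/-- `Λ(α; x, y) = 1 + (x² + y²) sinh² α - 2 x y sinh α cosh α`; it is positive for
`x, y ∈ [-1, 1]`. -/
def Lam (α x y : ℝ) : ℝ :=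
  1 + (x ^ 2 + y ^ 2) * Real.sinh α ^ 2 - 2 * x * y * Real.sinh α * Real.cosh α

/-- `Λ^{σ/2}`. -/
def LamPow (σ : ℂ) (α x y : ℝ) : ℂ := (Lam α x y : ℂ) ^ (σ / 2)

/-- The Gegenbauer weight `(1 - x²)^{(n-3)/2}`. -/
def weight (n : ℕ) (x : ℝ) : ℝ := (1 - x ^ 2) ^ (((n : ℝ) - 3) / 2)

/-- The normalization multiplier `a_μ^p`, for `p ≥ 3`. -/
def aOne (p mu : ℕ) : ℝ :=
  Real.Gamma (((p : ℝ) - 2) / 2) *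
    √((2 : ℝ) ^ ((p : ℝ) - 6) * (mu.factorial : ℝ) * (2 * (mu : ℝ) + p - 2) *
        Real.Gamma ((p : ℝ) / 2) /
      (Real.pi ^ ((7 : ℝ) / 2) * Real.Gamma ((mu : ℝ) + p - 2) *
        Real.Gamma (((p : ℝ) - 1) / 2)))

/-- The normalization multiplier `a_{λμ}^{pq}`, for `p, q ≥ 3`. -/
def aTwo (p q lam mu : ℕ) : ℝ :=
  Real.Gamma (((p : ℝ) - 2) / 2) * Real.Gamma (((q : ℝ) - 2) / 2) *
    √((2 : ℝ) ^ ((p : ℝ) + q - 8) * Real.Gamma ((p : ℝ) / 2) * Real.Gamma ((q : ℝ) / 2) /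
      (Real.pi ^ 3 * Real.Gamma (((p : ℝ) - 1) / 2) * Real.Gamma (((q : ℝ) - 1) / 2))) *
    √((lam.factorial : ℝ) * (mu.factorial : ℝ) * (2 * (mu : ℝ) + p - 2) *
        (2 * (lam : ℝ) + q - 2) /
      (Real.Gamma ((lam : ℝ) + q - 2) * Real.Gamma ((mu : ℝ) + p - 2)))

/-- `P_{σλμ}^{[p,q]}(α)` for `p, q ≥ 2`, by its integral representations: the variable `x = cos χ`
belongs to `p` and `μ`, the variable `y = cos φ` to `q` and `λ`; a variable that belongs to an
index `2` runs over a full circle, with an exponential in place of the Gegenbauer polynomial. -/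
def assocP (p q : ℕ) (σ : ℂ) (lam mu : ℕ) (α : ℝ) : ℂ :=
  if 3 ≤ p ∧ 3 ≤ q then
    (aTwo p q lam mu : ℂ) * ∫ y in (-1 : ℝ)..1, ∫ x in (-1 : ℝ)..1,
      LamPow σ α x y * (gegenbauer mu (((p : ℝ) - 2) / 2) x : ℂ) *
        (gegenbauer lam (((q : ℝ) - 2) / 2) y : ℂ) * (weight p x : ℂ) * (weight q y : ℂ)
  else if 3 ≤ p then
    (aOne p mu : ℂ) * ∫ x in (-1 : ℝ)..1, ∫ φ in (0 : ℝ)..(2 * Real.pi),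
      LamPow σ α x (Real.cos φ) * (gegenbauer mu (((p : ℝ) - 2) / 2) x : ℂ) *
        Complex.exp (-Complex.I * lam * φ) * (weight p x : ℂ)
  else if 3 ≤ q then
    (aOne q lam : ℂ) * ∫ y in (-1 : ℝ)..1, ∫ χ in (0 : ℝ)..(2 * Real.pi),
      LamPow σ α (Real.cos χ) y * (gegenbauer lam (((q : ℝ) - 2) / 2) y : ℂ) *
        Complex.exp (-Complex.I * mu * χ) * (weight q y : ℂ)
  else
    1 / (4 * (Real.pi : ℂ) ^ 2) *
      ∫ χ in (0 : ℝ)..(2 * Real.pi), ∫ φ in (0 : ℝ)..(2 * Real.pi),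
        LamPow σ α (Real.cos χ) (Real.cos φ) *
          Complex.exp (-Complex.I * ((lam : ℂ) * φ + (mu : ℂ) * χ))

/-- The associated function `ℙ_{σrs}^{pqν}(α) = P_{σλμ}^{[p,q]}(α)`, where `λ = ν + 2r` and
`μ = ν + 2s`. -/
def assocFn (p q ν : ℕ) (σ : ℂ) (r s : ℕ) (α : ℝ) : ℂ :=
  assocP p q σ (ν + 2 * r) (ν + 2 * s) α

/-- The zonal function `Z_σ^{[p,q]}(α)` for `p ≥ 2`, `q ≥ 1`: the mean of `Λ^{σ/2}` over the
product of the unit spheres of `ℝ^p` and `ℝ^q`. For `q = 1` the second sphere is `{±1}` and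
`Λ = (cosh α - x sinh α)²` at `y = 1`; the point `y = -1` gives the same mean. -/
def zonal (p q : ℕ) (σ : ℂ) (α : ℝ) : ℂ :=
  if q = 1 then
    if 3 ≤ p then
      ((Real.Gamma ((p : ℝ) / 2) / (√Real.pi * Real.Gamma (((p : ℝ) - 1) / 2)) : ℝ) : ℂ) *
        ∫ x in (-1 : ℝ)..1,
          ((Real.cosh α - x * Real.sinh α : ℝ) : ℂ) ^ σ * (weight p x : ℂ)
    else
      1 / (2 * (Real.pi : ℂ)) * ∫ χ in (0 : ℝ)..(2 * Real.pi),
        ((Real.cosh α - Real.cos χ * Real.sinh α : ℝ) : ℂ) ^ σ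
  else if 3 ≤ p ∧ 3 ≤ q then
    ((Real.Gamma ((p : ℝ) / 2) * Real.Gamma ((q : ℝ) / 2) /
        (Real.pi * Real.Gamma (((p : ℝ) - 1) / 2) * Real.Gamma (((q : ℝ) - 1) / 2)) : ℝ) : ℂ) *
      ∫ y in (-1 : ℝ)..1, ∫ x in (-1 : ℝ)..1,
        LamPow σ α x y * (weight p x : ℂ) * (weight q y : ℂ)
  else if 3 ≤ p then
    ((Real.Gamma ((p : ℝ) / 2) /
        (2 * Real.pi ^ ((3 : ℝ) / 2) * Real.Gamma (((p : ℝ) - 1) / 2)) : ℝ) : ℂ) *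
      ∫ x in (-1 : ℝ)..1, ∫ φ in (0 : ℝ)..(2 * Real.pi),
        LamPow σ α x (Real.cos φ) * (weight p x : ℂ)
  else if 3 ≤ q then
    ((Real.Gamma ((q : ℝ) / 2) /
        (2 * Real.pi ^ ((3 : ℝ) / 2) * Real.Gamma (((q : ℝ) - 1) / 2)) : ℝ) : ℂ) *
      ∫ y in (-1 : ℝ)..1, ∫ χ in (0 : ℝ)..(2 * Real.pi),
        LamPow σ α (Real.cos χ) y * (weight q y : ℂ)
  else
    1 / (4 * (Real.pi : ℂ) ^ 2) *
      ∫ χ in (0 : ℝ)..(2 * Real.pi), ∫ φ in (0 : ℝ)..(2 * Real.pi),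
        LamPow σ α (Real.cos χ) (Real.cos φ)

/-- The factor `A₁`. -/
def A1 (p q ν : ℕ) (σ : ℂ) (r s : ℕ) : ℂ :=
  poch (-σ / 2) (s + r + ν) *
    (((2 : ℝ) ^ (3 - ((p : ℝ) + q) / 2 - ν) /
        (Real.Gamma (2 * (s : ℝ) + ν + (p : ℝ) / 2) *
          Real.Gamma (2 * (r : ℝ) + ν + (q : ℝ) / 2)) *
      √(Real.pi * Real.Gamma ((p : ℝ) / 2) * Real.Gamma ((q : ℝ) / 2) /
        (Real.Gamma (((p : ℝ) - 1) / 2) * Real.Gamma (((q : ℝ) - 1) / 2))) *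
      √(Real.Gamma (2 * (s : ℝ) + ν + p - 1) * Real.Gamma (2 * (r : ℝ) + ν + q - 1) /
        (((2 * s + ν).factorial : ℝ) * ((2 * r + ν).factorial : ℝ))) : ℝ) : ℂ)

/-- `(l + (n-2)/2) / (l + n - 2)` for `n ≥ 3`; for `n = 2`, where the exponentials `e^{ilφ}` are
the normalized basis functions, the value is `1/2`. -/
def normRatio (n l : ℕ) : ℝ :=
  if n = 2 then 1 / 2 else ((l : ℝ) + ((n : ℝ) - 2) / 2) / ((l : ℝ) + n - 2)

/-- The factor `A₂`. -/
def A2 (p q ν r s : ℕ) : ℝ := √(normRatio p (2 * s + ν) * normRatio q (2 * r + ν))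

/-- The explicit factor in front of `(tanh α)^{2s+ν} / cosh α` and the Horn series, for `r ≤ s`. -/
def prefactor (p q ν : ℕ) (σ : ℂ) (r s : ℕ) : ℂ :=
  ((2 * s + ν).factorial : ℂ) * poch ((2 - σ - q) / 2) (s - r) /
    (((s - r).factorial : ℂ) * 4 ^ s * poch (2 * (r : ℂ) + ν + (q : ℂ) / 2) (s - r)) *
    A1 p q ν σ r s * (A2 p q ν r s : ℂ)

end SOpq

end

open SOpq

/-!
Put `t = tanh α` and `β = -σ / 2`, and let `u`, `v` be the roots of
`z ^ 2 - 2 x y z + (x ^ 2 + y ^ 2 - 1)`, so that `u = cos (χ - φ)` and `v = cos (χ + φ)` when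
`x = cos χ` and `y = cos φ`. Then

  `cosh α * Λ ^ (σ / 2) = (1 - t ^ 2) ^ (β - 1 / 2) * ((1 - u t) (1 - v t)) ^ (-β)`,

and the Taylor coefficients of the right-hand side in `t` come from Mehler's formula: they are the
polynomials `H_n(√z x) H_n(√z y) / (2 ^ n n!)` with every power `z ^ k` replaced by `(β)_k`, in
other words averaged against the gamma distribution. Both families satisfy the same first order
differential equation, which links `β` and `β + 1` and determines them from their constant terms.

In these coefficients `x` and `y` are separated, so the expansion can be integrated term by term
against the basis functions of the two spheres. For the basis function of degree `l` on the unit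
sphere of `ℝ^n` the moment of order `l + 2 i` is a constant times
`(l + 2 i)! / (4 ^ i i! (l + n / 2)_i)`, in every dimension, and the other moments vanish.
The resulting terminating double sums in Pochhammer symbols collapse to the single sums over
`m + n = N` in the Horn series.
-/

namespace SOpq

noncomputable section

section Pochhammer

open Finset

@[simp]
lemma poch_zero (a : ℂ) : poch a 0 = 1 := by simp [poch]

lemma poch_succ (a : ℂ) (n : ℕ) : poch a (n + 1) = poch a n * (a + n) := by
  simp [poch, ascPochhammer_succ_eval]

lemma poch_add (a : ℂ) (m n : ℕ) : poch a (m + n) = poch a m * poch (a + m) n := by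
  induction n with
  | zero => simp
  | succ n ih => rw [← add_assoc, poch_succ, ih, poch_succ]; push_cast; ring

lemma poch_succ_left (a : ℂ) (n : ℕ) : poch a (n + 1) = a * poch (a + 1) n := by
  rw [add_comm n 1, poch_add, poch_succ]; simp

lemma poch_one (n : ℕ) : poch 1 n = n.factorial := by
  simp [poch]

lemma poch_ofReal (a : ℝ) (n : ℕ) : poch (a : ℂ) n = (((ascPochhammer ℝ n).eval a : ℝ) : ℂ) := by
  induction n with
  | zero => simp
  | succ n ih => rw [poch_succ, ih, ascPochhammer_succ_eval]; push_cast; ring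

lemma poch_ofReal_ne_zero {a : ℝ} (ha : 0 < a) (n : ℕ) : poch (a : ℂ) n ≠ 0 := by
  rw [poch_ofReal]
  exact_mod_cast (ascPochhammer_pos n a ha).ne'

lemma factorial_mul_poch (m n : ℕ) :
    (m.factorial : ℂ) * poch ((m : ℂ) + 1) n = ((m + n).factorial : ℂ) := by
  rw [← poch_one, ← poch_one, poch_add, add_comm (m : ℂ)]

lemma factorial_cast_ne_zero (n : ℕ) : (n.factorial : ℂ) ≠ 0 :=
  Nat.cast_ne_zero.mpr n.factorial_ne_zero

lemma poch_one_sub_sub (a : ℂ) (n : ℕ) : poch (1 - a - n) n = (-1) ^ n * poch a n := by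
  induction n with
  | zero => simp
  | succ n ih =>
    have shift : 1 - a - ((n + 1 : ℕ) : ℂ) + 1 = 1 - a - n := by push_cast; ring
    rw [poch_succ_left, poch_succ, shift, ih]
    push_cast
    ring

lemma multichoose_eq_poch_div_factorial (c : ℂ) (n : ℕ) :
    Ring.multichoose c n = poch c n / n.factorial := by
  rw [eq_div_iff (factorial_cast_ne_zero n), mul_comm, ← nsmul_eq_mul,
    Ring.factorial_nsmul_multichoose_eq_ascPochhammer,
    Polynomial.ascPochhammer_smeval_eq_eval, poch]

lemma sum_antidiagonal_poch_div_mul_poch_div (x y : ℂ) (n : ℕ) :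
    ∑ ij ∈ antidiagonal n,
        poch x ij.1 / ij.1.factorial * (poch y ij.2 / ij.2.factorial) =
      poch (x + y) n / n.factorial := by
  simp only [← multichoose_eq_poch_div_factorial]
  refine MulAction.injective (Int.negOnePow n) ?_
  dsimp only
  rw [← Ring.choose_neg', neg_add, Ring.add_choose_eq n (Commute.all _ _), smul_sum]
  refine sum_congr rfl fun ij hij => ?_
  rw [Ring.choose_neg', Ring.choose_neg', smul_mul_smul_comm, ← Int.negOnePow_add, ← Nat.cast_add,
    HasAntidiagonal.mem_antidiagonal.mp hij]

lemma sum_antidiagonal_sum_antidiagonal_assoc {M : Type*} [AddCommMonoid M] (f : ℕ → ℕ → ℕ → M)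
    (n : ℕ) :
    ∑ ij ∈ antidiagonal n, ∑ kl ∈ antidiagonal ij.2, f ij.1 kl.1 kl.2 =
      ∑ ij ∈ antidiagonal n, ∑ kl ∈ antidiagonal ij.1, f kl.1 kl.2 ij.2 := by
  rw [sum_sigma', sum_sigma']
  refine sum_nbij' (fun x => ⟨(x.1.1 + x.2.1, x.2.2), (x.1.1, x.2.1)⟩)
    (fun x => ⟨(x.2.1, x.2.2 + x.1.2), (x.2.2, x.1.2)⟩) ?_ ?_ ?_ ?_ ?_ <;>
    rintro ⟨⟨i, j⟩, ⟨k, l⟩⟩ h <;>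
    simp only [mem_sigma, HasAntidiagonal.mem_antidiagonal] at h ⊢ <;>
    grind

lemma sum_antidiagonal_three_poch_transform (a c f g : ℂ) (n : ℕ) :
    ∑ ij ∈ antidiagonal n, poch a ij.1 * poch (c + ij.1) ij.2 * poch (g - f) ij.1 * poch f ij.2 /
        ((ij.1.factorial : ℂ) * (ij.2.factorial : ℂ)) =
      ∑ ij ∈ antidiagonal n, poch a ij.1 * poch (c - a) ij.2 * poch f ij.2 *
        poch (g + ij.2) ij.1 / ((ij.1.factorial : ℂ) * (ij.2.factorial : ℂ)) := by
  let term (i k l : ℕ) : ℂ := poch a (i + k) / k.factorial * (poch (c - a) l / l.factorial) *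
    (poch (g - f) i / i.factorial) * poch f (k + l)
  have expand_left (i j : ℕ) :
      poch a i * poch (c + i) j * poch (g - f) i * poch f j / (i.factorial * j.factorial) =
        ∑ kl ∈ antidiagonal j, term i kl.1 kl.2 := by
    have vandermonde := sum_antidiagonal_poch_div_mul_poch_div (a + i) (c - a) j
    rw [show a + i + (c - a) = c + i by ring] at vandermonde
    calc _ = poch (c + i) j / j.factorial *
          (poch a i * (poch (g - f) i / i.factorial) * poch f j) := by ring
      _ = _ := by
        rw [← vandermonde, sum_mul]
        refine sum_congr rfl fun kl hkl => ?_
        simp only [term, poch_add a, HasAntidiagonal.mem_antidiagonal.mp hkl]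
        ring
  have expand_right (i j : ℕ) :
      poch a i * poch (c - a) j * poch f j * poch (g + j) i / (i.factorial * j.factorial) =
        ∑ kl ∈ antidiagonal i, term kl.1 kl.2 j := by
    have vandermonde := sum_antidiagonal_poch_div_mul_poch_div (g - f) (f + j) i
    rw [show g - f + (f + j) = g + j by ring] at vandermonde
    calc _ = poch (g + j) i / i.factorial *
          (poch a i * (poch (c - a) j / j.factorial) * poch f j) := by ring
      _ = _ := by
        rw [← vandermonde, sum_mul]
        refine sum_congr rfl fun kl hkl => ?_
        simp only [term, HasAntidiagonal.mem_antidiagonal.mp hkl]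
        rw [add_comm kl.2, poch_add f]
        ring
  simp only [expand_left, expand_right, sum_antidiagonal_sum_antidiagonal_assoc]

lemma poch_sub_natCast {N i : ℕ} (hi : i ≤ N) (e : ℂ) (δ : ℕ) :
    poch (e - i) (N + δ) = (-1) ^ i * poch (1 - e) i * poch e δ * poch (e + δ) (N - i) := by
  obtain ⟨k, rfl⟩ := Nat.exists_eq_add_of_le hi
  have reflection := poch_one_sub_sub (1 - e) i
  rw [sub_sub_cancel] at reflection
  rw [show i + k + δ = i + (δ + k) by ring, poch_add, poch_add, reflection, sub_add_cancel,
    add_tsub_cancel_left]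
  ring

lemma sum_antidiagonal_neg_one_pow_mul_poch_div (a : ℂ) {d : ℂ} {n : ℕ} (hd : poch d n ≠ 0) :
    ∑ jl ∈ antidiagonal n, (-1) ^ jl.2 * poch a jl.1 /
      ((jl.1.factorial : ℂ) * (jl.2.factorial : ℂ) * poch d jl.1) =
      (-1) ^ n * poch (d - a) n / ((n.factorial : ℂ) * poch d n) := by
  have vandermonde := sum_antidiagonal_poch_div_mul_poch_div a (1 - d - n) n
  rw [show a + (1 - d - n) = 1 - (d - a) - n by ring, poch_one_sub_sub] at vandermonde
  rw [mul_comm (n.factorial : ℂ), div_mul_eq_div_div_swap, ← vandermonde, sum_div]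
  refine sum_congr rfl fun jl hjl => ?_
  obtain rfl := HasAntidiagonal.mem_antidiagonal.mp hjl
  have reflection := poch_one_sub_sub (d + jl.1) jl.2
  rw [show 1 - (d + jl.1) - (jl.2 : ℂ) = 1 - d - (jl.1 + jl.2 : ℕ) by push_cast; ring]
    at reflection
  rw [poch_add] at hd
  rw [reflection, poch_add]
  have hd_left := left_ne_zero_of_mul hd
  have hd_right := right_ne_zero_of_mul hd
  field_simp

lemma sum_antidiagonal_neg_one_pow_mul_poch_add_div (a : ℂ) {d : ℂ} {i k δ : ℕ}
    (hd : poch d (i + k + δ) ≠ 0) :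
    ∑ jl ∈ antidiagonal (i + k + δ), (-1) ^ (k + jl.2) * poch a (i + jl.1) /
        ((jl.1.factorial : ℂ) * (jl.2.factorial : ℂ) * poch d jl.1) =
      (-1) ^ δ * poch a i * poch (1 - (d - a)) i * poch (d - a) δ * poch (d - a + δ) k /
        (((i + k + δ).factorial : ℂ) * poch d (i + k + δ)) := by
  have single_sum := sum_antidiagonal_neg_one_pow_mul_poch_div (a + i) hd
  rw [← sub_sub, poch_sub_natCast (Nat.le_add_right i k), add_tsub_cancel_left] at single_sum
  calc _ = (-1) ^ k * poch a i * ∑ jl ∈ antidiagonal (i + k + δ), (-1) ^ jl.2 *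
        poch (a + i) jl.1 / ((jl.1.factorial : ℂ) * (jl.2.factorial : ℂ) * poch d jl.1) := by
        rw [mul_sum]
        refine sum_congr rfl fun jl _ => ?_
        rw [poch_add a, pow_add]
        ring
    _ = _ := by
        have sign : (-1 : ℂ) ^ k * (-1) ^ (i + k + δ) * (-1) ^ i = (-1) ^ δ := by
          rw [← pow_add, ← pow_add, show k + (i + k + δ) + i = δ + 2 * (i + k) by ring, pow_add,
            pow_mul]
          simp
        rw [single_sum, ← sign]
        ring

lemma sum_sum_antidiagonal_poch_div (a : ℂ) {c d : ℂ} {N δ : ℕ} (hc : poch c N ≠ 0)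
    (hd : poch d (N + δ) ≠ 0) :
    ∑ ik ∈ antidiagonal N, ∑ jl ∈ antidiagonal (N + δ), (-1) ^ (ik.2 + jl.2) *
      poch a (ik.1 + jl.1) / ((ik.1.factorial : ℂ) * (ik.2.factorial : ℂ) * poch c ik.1 *
        ((jl.1.factorial : ℂ) * (jl.2.factorial : ℂ) * poch d jl.1)) =
    (-1) ^ δ * poch (d - a) δ / ((δ.factorial : ℂ) * poch d (N + δ) * poch c N) *
      ∑ mn ∈ antidiagonal N, poch a mn.1 * poch (c - a) mn.2 * poch (d - a + δ) mn.2 /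
        ((mn.1.factorial : ℂ) * (mn.2.factorial : ℂ) * poch (1 + δ) mn.2) := by
  have inner_sum : ∀ ik ∈ antidiagonal N, ∑ jl ∈ antidiagonal (N + δ), (-1) ^ (ik.2 + jl.2) *
      poch a (ik.1 + jl.1) / ((ik.1.factorial : ℂ) * (ik.2.factorial : ℂ) * poch c ik.1 *
        ((jl.1.factorial : ℂ) * (jl.2.factorial : ℂ) * poch d jl.1)) =
      (-1) ^ δ * poch (d - a) δ / (((N + δ).factorial : ℂ) * poch d (N + δ) * poch c N) *
      (poch a ik.1 * poch (c + ik.1) ik.2 * poch ((1 + δ) - (d - a + δ)) ik.1 *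
        poch (d - a + δ) ik.2 / ((ik.1.factorial : ℂ) * (ik.2.factorial : ℂ))) := by
    rintro ⟨i, k⟩ hik
    obtain rfl : i + k = N := HasAntidiagonal.mem_antidiagonal.mp hik
    have reduce := sum_antidiagonal_neg_one_pow_mul_poch_add_div a hd
    rw [poch_add c] at hc ⊢
    have hc_left := left_ne_zero_of_mul hc
    have hc_right := right_ne_zero_of_mul hc
    simp only [mul_comm (_ * poch c i), div_mul_eq_div_div _ _ (_ * poch c i), ← sum_div, reduce,
      add_sub_add_right_eq_sub]
    field_simp
  rw [sum_congr rfl inner_sum, ← mul_sum, sum_antidiagonal_three_poch_transform, mul_sum, mul_sum]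
  refine sum_congr rfl fun mn hmn => ?_
  obtain rfl := HasAntidiagonal.mem_antidiagonal.mp hmn
  have factorial_split : (((mn.1 + mn.2 + δ).factorial : ℕ) : ℂ) =
      (δ.factorial : ℂ) * (poch (1 + δ) mn.2 * poch (1 + δ + mn.2) mn.1) := by
    rw [← poch_add, add_comm _ δ, add_comm mn.1, ← factorial_mul_poch, add_comm (δ : ℂ)]
  have split_ne_zero := factorial_cast_ne_zero (mn.1 + mn.2 + δ)
  rw [factorial_split, mul_ne_zero_iff, mul_ne_zero_iff] at split_ne_zero
  obtain ⟨-, hpoch_left, hpoch_right⟩ := split_ne_zero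
  rw [factorial_split]
  field_simp

end Pochhammer

section KernelSeries

open PowerSeries

/-- The power series `∑ (c)_n / n! w^n X^n` of `(1 - w X)^{-c}`. -/
def binSeries (c w : ℂ) : PowerSeries ℂ := .mk fun n => poch c n / (n.factorial : ℂ) * w ^ n

lemma coeff_binSeries (c w : ℂ) (n : ℕ) :
    coeff n (binSeries c w) = poch c n / (n.factorial : ℂ) * w ^ n := by
  simp [binSeries]

lemma constantCoeff_binSeries (c w : ℂ) : constantCoeff (binSeries c w) = 1 := by
  rw [← coeff_zero_eq_constantCoeff_apply, coeff_binSeries]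
  simp

lemma one_sub_mul_binSeries (c w : ℂ) :
    (1 - C w * X) * binSeries (c + 1) w = binSeries c w := by
  ext n
  rw [sub_mul, one_mul, mul_assoc, map_sub, coeff_C_mul]
  cases n with
  | zero => simp [coeff_binSeries]
  | succ n =>
    rw [coeff_succ_X_mul, coeff_binSeries, coeff_binSeries, coeff_binSeries, poch_succ,
      poch_succ_left, Nat.factorial_succ]
    have := factorial_cast_ne_zero n
    have : (n : ℂ) + 1 ≠ 0 := n.cast_add_one_ne_zero
    push_cast
    field_simp
    ring

lemma derivative_binSeries (c w : ℂ) :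
    d⁄dX ℂ (binSeries c w) = C (c * w) * binSeries (c + 1) w := by
  ext n
  rw [coeff_derivative, coeff_C_mul, coeff_binSeries, coeff_binSeries, poch_succ_left,
    Nat.factorial_succ]
  have : (n : ℂ) + 1 ≠ 0 := n.cast_add_one_ne_zero
  push_cast
  field_simp
  ring

/-- The power series of `(1 - X²)^{β - 1/2} ((1 - u X) (1 - v X))^{-β}`. For `β = -σ/2`,
`X = tanh α`, `u + v = 2xy` and `uv = x² + y² - 1` this is `cosh α · Λ^{σ/2}`. -/
def kernelSeries (u v β : ℂ) : PowerSeries ℂ :=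
  binSeries (1 / 2 - β) 1 * binSeries (1 / 2 - β) (-1) * binSeries β u * binSeries β v

/-- The differential equation that characterizes the family `kernelSeries u v`, with `S = u + v`
and `R = 2 (u v + 1)`. It raises the parameter `β` instead of dividing by `(1 - u X) (1 - v X)`. -/
def KernelEq (S R : ℂ) (G : ℂ → PowerSeries ℂ) : Prop :=
  ∀ β, (1 - X ^ 2) ^ 2 * d⁄dX ℂ (G β) = X * (1 - X ^ 2) * G β +
    C β * (C S * (1 + X ^ 2) - C R * X) * G (β + 1)

lemma kernelEq_kernelSeries (u v : ℂ) :
    KernelEq (u + v) (2 * (u * v + 1)) (kernelSeries u v) := by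
  intro β
  have lower_half (w : ℂ) :
      (1 - C w * X) * binSeries (3 / 2 - β) w = binSeries (1 / 2 - β) w := by
    rw [← one_sub_mul_binSeries (1 / 2 - β), show (1 / 2 - β : ℂ) + 1 = 3 / 2 - β by ring]
  have lower_neg_half (w : ℂ) : (1 - C w * X) * binSeries (1 / 2 - β) w =
      binSeries (1 / 2 - (β + 1)) w := by
    rw [← one_sub_mul_binSeries (1 / 2 - (β + 1)),
      show (1 / 2 - (β + 1) : ℂ) + 1 = 1 / 2 - β by ring]
  have two_mul_half : (2 : PowerSeries ℂ) * C (1 / 2 : ℂ) = 1 := by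
    rw [← map_ofNat (C (R := ℂ)), ← map_mul]
    simp
  simp only [kernelSeries, Derivation.leibniz, derivative_binSeries, smul_eq_mul,
    show (1 / 2 - β : ℂ) + 1 = 3 / 2 - β by ring]
  simp only [← lower_neg_half, ← lower_half, ← one_sub_mul_binSeries β, map_sub, map_mul, map_add,
    map_one, map_neg, map_ofNat]
  linear_combination (X * (1 - X ^ 2) ^ 2 * (1 - C u * X) * (1 - C v * X) *
    binSeries (3 / 2 - β) 1 * binSeries (3 / 2 - β) (-1) * binSeries (β + 1) u *
    binSeries (β + 1) v) * two_mul_half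

lemma X_pow_dvd_derivative {f : PowerSeries ℂ} {n : ℕ} (h : X ^ (n + 1) ∣ f) :
    X ^ n ∣ d⁄dX ℂ f := by
  rw [X_pow_dvd_iff] at h ⊢
  intro m hm
  rw [coeff_derivative, h (m + 1) (by lia), zero_mul]

lemma X_pow_succ_dvd_of_X_pow_dvd_derivative {f : PowerSeries ℂ} {n : ℕ}
    (hf : constantCoeff f = 0) (h : X ^ n ∣ d⁄dX ℂ f) : X ^ (n + 1) ∣ f := by
  rw [X_pow_dvd_iff] at h ⊢
  rintro (_ | m) hm
  · simpa using hf
  · have derivative_coeff := h m (by lia)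
    rw [coeff_derivative] at derivative_coeff
    exact (mul_eq_zero.mp derivative_coeff).resolve_right m.cast_add_one_ne_zero

lemma KernelEq.unique {S R : ℂ} {G H : ℂ → PowerSeries ℂ} (hG : KernelEq S R G)
    (hH : KernelEq S R H) (h0 : ∀ β, constantCoeff (G β) = constantCoeff (H β)) (β : ℂ) :
    G β = H β := by
  have agree_to_order (n : ℕ) : ∀ β, X ^ (n + 1) ∣ G β - H β := by
    induction n with
    | zero => simp [X_dvd_iff, h0]
    | succ n ih =>
      intro β
      have derivative_eq : d⁄dX ℂ (G β - H β) =
          X * (X * (2 - X ^ 2) * d⁄dX ℂ (G β - H β)) + X * (1 - X ^ 2) * (G β - H β) +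
            C β * (C S * (1 + X ^ 2) - C R * X) * (G (β + 1) - H (β + 1)) := by
        rw [map_sub]
        linear_combination hG β - hH β
      refine X_pow_succ_dvd_of_X_pow_dvd_derivative (by simp [h0]) ?_
      rw [derivative_eq]
      refine dvd_add (dvd_add ?_ ((ih β).mul_left _)) ((ih (β + 1)).mul_left _)
      rw [pow_succ']
      exact mul_dvd_mul_left _ ((X_pow_dvd_derivative (ih β)).mul_left _)
  rw [← sub_eq_zero]
  ext n
  simpa using X_pow_dvd_iff.mp (agree_to_order n β) n (by lia)

end KernelSeries

section Hermite

open Finset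

lemma sum_range_half_recurrence {R : Type*} [CommRing R] (g : ℕ → ℕ → R) (z : R) (n : ℕ)
    (A B D : R) (h_top : A * g (n + 2) 0 = B * g (n + 1) 0)
    (h_mid : ∀ k, 2 * k + 1 ≤ n → A * g (n + 2) (k + 1) = B * g (n + 1) (k + 1) - D * g n k)
    (h_bot : ∀ k, n = 2 * k → A * g (n + 2) (k + 1) = -(D * g n k)) :
    A * ∑ k ∈ range ((n + 2) / 2 + 1), g (n + 2) k * z ^ (n + 2 - 2 * k) =
      B * z * ∑ k ∈ range ((n + 1) / 2 + 1), g (n + 1) k * z ^ (n + 1 - 2 * k) -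
      D * ∑ k ∈ range (n / 2 + 1), g n k * z ^ (n - 2 * k) := by
  have extend_range (m N : ℕ) (hN : m / 2 < N) :
      ∑ k ∈ range (m / 2 + 1), g m k * z ^ (m - 2 * k) =
        ∑ k ∈ range N, if 2 * k ≤ m then g m k * z ^ (m - 2 * k) else 0 := by
    rw [← sum_filter]
    refine sum_congr ?_ fun _ _ => rfl
    ext k
    simp only [mem_range, mem_filter]
    lia
  rw [extend_range (n + 2) (n + 3) (by lia), extend_range (n + 1) (n + 3) (by lia),
    extend_range n (n + 2) (by lia), sum_range_succ', sum_range_succ' (n := n + 2), mul_add,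
    mul_add, mul_sum, mul_sum, mul_sum, add_sub_right_comm, ← sum_sub_distrib]
  congr 1
  · refine sum_congr rfl fun k _ => ?_
    rcases lt_trichotomy n (2 * k) with h | h | h
    · rw [if_neg (by lia), if_neg (by lia), if_neg (by lia)]
      simp
    · rw [if_pos (by lia), if_neg (by lia), if_pos (by lia), ← mul_assoc, h_bot k h,
        show n + 2 - 2 * (k + 1) = n - 2 * k by lia]
      ring
    · rw [if_pos (by lia), if_pos (by lia), if_pos (by lia), ← mul_assoc, h_mid k h,
        show n + 2 - 2 * (k + 1) = n + 1 - 2 * (k + 1) + 1 by lia,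
        show n - 2 * k = n + 1 - 2 * (k + 1) + 1 by lia, pow_succ]
      ring
  · simp only [mul_zero, zero_le, if_true, tsub_zero]
    rw [← mul_assoc, h_top, pow_succ]
    ring

/-- The coefficient of `(2z)^{n-2k}` in `H_n(z) / n!`. -/
def hermCoeff (n k : ℕ) : ℂ := (-1) ^ k / ((k.factorial : ℂ) * ((n - 2 * k).factorial : ℂ))

/-- The physicists' Hermite polynomials divided by `n!`. -/
def herm (n : ℕ) (z : ℂ) : ℂ := ∑ k ∈ range (n / 2 + 1), hermCoeff n k * (2 * z) ^ (n - 2 * k)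

lemma hermCoeff_add_two_zero (n : ℕ) :
    ((n : ℂ) + 2) * hermCoeff (n + 2) 0 = 1 * hermCoeff (n + 1) 0 := by
  have := factorial_cast_ne_zero (n + 1)
  have : (n : ℂ) + 2 ≠ 0 := mod_cast (n + 1).succ_ne_zero
  simp only [hermCoeff, mul_zero, tsub_zero, Nat.factorial_succ (n + 1)]
  push_cast
  rw [show (n : ℂ) + 1 + 1 = n + 2 by ring]
  field_simp

lemma hermCoeff_add_two_succ {n k : ℕ} (hk : 2 * k + 1 ≤ n) :
    ((n : ℂ) + 2) * hermCoeff (n + 2) (k + 1) =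
      1 * hermCoeff (n + 1) (k + 1) - 2 * hermCoeff n k := by
  obtain ⟨m, rfl⟩ := Nat.exists_eq_add_of_le hk
  have := factorial_cast_ne_zero m
  have := factorial_cast_ne_zero k
  have : (k : ℂ) + 1 ≠ 0 := k.cast_add_one_ne_zero
  have : (m : ℂ) + 1 ≠ 0 := m.cast_add_one_ne_zero
  simp only [hermCoeff, Nat.factorial_succ, show 2 * k + 1 + m + 2 - 2 * (k + 1) = m + 1 by lia,
    show 2 * k + 1 + m + 1 - 2 * (k + 1) = m by lia,
    show 2 * k + 1 + m - 2 * k = m + 1 by lia]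
  push_cast
  field_simp
  ring

lemma hermCoeff_two_mul_add_two (k : ℕ) :
    ((2 * k : ℕ) + 2 : ℂ) * hermCoeff (2 * k + 2) (k + 1) = -(2 * hermCoeff (2 * k) k) := by
  have := factorial_cast_ne_zero k
  have : (k : ℂ) + 1 ≠ 0 := k.cast_add_one_ne_zero
  simp only [hermCoeff, Nat.factorial_succ, Nat.sub_self,
    show 2 * k + 2 - 2 * (k + 1) = 0 by lia]
  push_cast
  field_simp
  ring

lemma herm_recurrence (n : ℕ) (z : ℂ) :
    ((n : ℂ) + 2) * herm (n + 2) z = 2 * z * herm (n + 1) z - 2 * herm n z := by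
  simpa only [herm, one_mul] using sum_range_half_recurrence hermCoeff (2 * z) n ((n : ℂ) + 2) 1 2
    (hermCoeff_add_two_zero n) (fun _ => hermCoeff_add_two_succ)
    (by rintro k rfl; exact hermCoeff_two_mul_add_two k)

lemma herm_zero (z : ℂ) : herm 0 z = 1 := by simp [herm, hermCoeff]

lemma herm_one (z : ℂ) : herm 1 z = 2 * z := by simp [herm, hermCoeff]

lemma herm_two (z : ℂ) : herm 2 z = 2 * z ^ 2 - 1 := by
  have recurrence := herm_recurrence 0 z
  simp only [Nat.cast_zero, zero_add, herm_one, herm_zero] at recurrence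
  linear_combination recurrence / 2

lemma herm_three (z : ℂ) : herm 3 z = (4 * z ^ 3 - 6 * z) / 3 := by
  have recurrence := herm_recurrence 1 z
  simp only [Nat.cast_one, Nat.reduceAdd, herm_one, herm_two] at recurrence
  linear_combination recurrence / 3

/-- `H_n(u) H_n(v) / (2^n n!)`, the coefficients of Mehler's formula. -/
def hermProd (u v : ℂ) (n : ℕ) : ℂ := (n.factorial : ℂ) / 2 ^ n * (herm n u * herm n v)

lemma hermProd_recurrence (u v : ℂ) (n : ℕ) :
    ((n : ℂ) + 4) * hermProd u v (n + 4) - (2 * n + 5) * hermProd u v (n + 2) +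
      (n + 1) * hermProd u v n =
    2 * u * v * (hermProd u v (n + 3) + hermProd u v (n + 1)) -
      2 * (u ^ 2 + v ^ 2) * hermProd u v (n + 2) := by
  have two_ne : (n : ℂ) + 2 ≠ 0 := mod_cast (n + 1).succ_ne_zero
  have three_ne : (n : ℂ) + 3 ≠ 0 := mod_cast (n + 2).succ_ne_zero
  have four_ne : (n : ℂ) + 4 ≠ 0 := mod_cast (n + 3).succ_ne_zero
  have herm_add_two (z : ℂ) :
      herm (n + 2) z = (2 * z * herm (n + 1) z - 2 * herm n z) / (n + 2) :=
    eq_div_of_mul_eq two_ne (by linear_combination herm_recurrence n z)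
  have herm_add_three (z : ℂ) :
      herm (n + 3) z = (2 * z * herm (n + 2) z - 2 * herm (n + 1) z) / (n + 3) := by
    have recurrence := herm_recurrence (n + 1) z
    push_cast at recurrence
    exact eq_div_of_mul_eq three_ne (by linear_combination recurrence)
  have herm_add_four (z : ℂ) :
      herm (n + 4) z = (2 * z * herm (n + 3) z - 2 * herm (n + 2) z) / (n + 4) := by
    have recurrence := herm_recurrence (n + 2) z
    push_cast at recurrence
    exact eq_div_of_mul_eq four_ne (by linear_combination recurrence)
  simp only [hermProd, Nat.factorial_succ, pow_succ]
  rw [herm_add_four u, herm_add_four v, herm_add_three u, herm_add_three v, herm_add_two u,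
    herm_add_two v]
  push_cast
  rw [show (n : ℂ) + 3 + 1 = n + 4 by ring, show (n : ℂ) + 2 + 1 = n + 3 by ring,
    show (n : ℂ) + 1 + 1 = n + 2 by ring]
  field_simp
  ring

end Hermite

section Mehler

open Finset Polynomial

/-- The polynomial in `z` whose value is `H_n(√z x) H_n(√z y) / (2^n n!)`. -/
def mehlerPoly (x y : ℂ) (n : ℕ) : ℂ[X] :=
  C ((n.factorial : ℂ) / 2 ^ n) *
    ∑ a ∈ range (n / 2 + 1), ∑ b ∈ range (n / 2 + 1),
      C (hermCoeff n a * (2 * x) ^ (n - 2 * a) *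
        (hermCoeff n b * (2 * y) ^ (n - 2 * b))) * X ^ (n - a - b)

lemma eval_sq_mehlerPoly (x y z : ℂ) (n : ℕ) :
    (mehlerPoly x y n).eval (z ^ 2) = hermProd (z * x) (z * y) n := by
  simp only [mehlerPoly, hermProd, herm, eval_mul, eval_C, eval_finsetSum, eval_pow, eval_X,
    sum_mul_sum]
  congr 1
  refine sum_congr rfl fun a ha => sum_congr rfl fun b hb => ?_
  rw [mem_range] at ha hb
  have split_power : (z ^ 2) ^ (n - a - b) = z ^ (n - 2 * a) * z ^ (n - 2 * b) := by
    rw [← pow_mul, ← pow_add]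
    congr 1
    lia
  rw [split_power, show 2 * (z * x) = z * (2 * x) by ring,
    show 2 * (z * y) = z * (2 * y) by ring, mul_pow z, mul_pow z]
  ring

lemma polynomial_ext_sq {K : Type*} [Field K] [IsAlgClosed K] {P Q : K[X]}
    (h : ∀ z : K, P.eval (z ^ 2) = Q.eval (z ^ 2)) : P = Q := by
  have := IsAlgClosed.instInfinite (K := K)
  refine Polynomial.funext fun w => ?_
  obtain ⟨z, rfl⟩ := IsAlgClosed.exists_pow_nat_eq w zero_lt_two
  exact h z

lemma mehlerPoly_recurrence (x y : ℂ) (n : ℕ) :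
    C ((n : ℂ) + 4) * mehlerPoly x y (n + 4) - C (2 * (n : ℂ) + 5) * mehlerPoly x y (n + 2) +
      C ((n : ℂ) + 1) * mehlerPoly x y n =
    X * (C (2 * x * y) * (mehlerPoly x y (n + 3) + mehlerPoly x y (n + 1)) -
      C (2 * (x ^ 2 + y ^ 2)) * mehlerPoly x y (n + 2)) := by
  refine polynomial_ext_sq fun z => ?_
  simp only [eval_sub, eval_add, eval_mul, eval_C, eval_X, eval_sq_mehlerPoly]
  linear_combination hermProd_recurrence (z * x) (z * y) n

lemma mehlerPoly_zero (x y : ℂ) : mehlerPoly x y 0 = 1 := by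
  simp [mehlerPoly, hermCoeff]

lemma mehlerPoly_one (x y : ℂ) : mehlerPoly x y 1 = X * (C (2 * x * y) * mehlerPoly x y 0) := by
  refine polynomial_ext_sq fun z => ?_
  simp only [eval_mul, eval_C, eval_X, eval_sq_mehlerPoly, hermProd, herm_one, herm_zero,
    Nat.factorial]
  norm_num
  ring

lemma mehlerPoly_two (x y : ℂ) : C 2 * mehlerPoly x y 2 - mehlerPoly x y 0 =
    X * (C (2 * x * y) * mehlerPoly x y 1 - C (2 * (x ^ 2 + y ^ 2)) * mehlerPoly x y 0) := by
  refine polynomial_ext_sq fun z => ?_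
  simp only [eval_sub, eval_mul, eval_C, eval_X, eval_sq_mehlerPoly, hermProd, herm_one, herm_zero,
    herm_two, Nat.factorial]
  norm_num
  ring

lemma mehlerPoly_three (x y : ℂ) : C 3 * mehlerPoly x y 3 - C 3 * mehlerPoly x y 1 =
    X * (C (2 * x * y) * (mehlerPoly x y 2 + mehlerPoly x y 0) -
      C (2 * (x ^ 2 + y ^ 2)) * mehlerPoly x y 1) := by
  refine polynomial_ext_sq fun z => ?_
  simp only [eval_sub, eval_add, eval_mul, eval_C, eval_X, eval_sq_mehlerPoly, hermProd, herm_one,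
    herm_zero, herm_two, herm_three, Nat.factorial]
  norm_num
  ring

/-- The linear functional on polynomials with `X ^ n ↦ (β)_n`, that is, integration against the
Gamma distribution `z^{β-1} e^{-z} dz / Γ(β)` where the latter makes sense. -/
def gammaFunctional (β : ℂ) : ℂ[X] →ₗ[ℂ] ℂ :=
  Polynomial.lsum fun n => poch β n • LinearMap.id

lemma gammaFunctional_C_mul_X_pow (β c : ℂ) (n : ℕ) :
    gammaFunctional β (C c * X ^ n) = c * poch β n := by
  rw [C_mul_X_pow_eq_monomial, gammaFunctional, lsum_apply, sum_monomial_index] <;> simp [mul_comm]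

lemma gammaFunctional_one (β : ℂ) : gammaFunctional β 1 = 1 := by
  simpa using gammaFunctional_C_mul_X_pow β 1 0

lemma gammaFunctional_C_mul (β c : ℂ) (P : ℂ[X]) :
    gammaFunctional β (C c * P) = c * gammaFunctional β P := by
  rw [← smul_eq_C_mul, map_smul, smul_eq_mul]

lemma gammaFunctional_X_mul (β : ℂ) (P : ℂ[X]) :
    gammaFunctional β (X * P) = β * gammaFunctional (β + 1) P := by
  induction P using Polynomial.induction_on' with
  | add p q hp hq => rw [mul_add, map_add, hp, hq, map_add, mul_add]
  | monomial n a =>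
    rw [← C_mul_X_pow_eq_monomial, gammaFunctional_C_mul_X_pow, mul_left_comm, ← pow_succ',
      gammaFunctional_C_mul_X_pow, poch_succ_left]
    ring

/-- The `n`-th Taylor coefficient in `tanh α` of `cosh α · Λ^{-β}`. -/
def mehlerCoeff (β x y : ℂ) (n : ℕ) : ℂ := gammaFunctional β (mehlerPoly x y n)

lemma mehlerCoeff_eq (β x y : ℂ) (n : ℕ) :
    mehlerCoeff β x y n = (n.factorial : ℂ) / 2 ^ n *
      ∑ a ∈ range (n / 2 + 1), ∑ b ∈ range (n / 2 + 1),
        (hermCoeff n a * (2 * x) ^ (n - 2 * a) * (hermCoeff n b * (2 * y) ^ (n - 2 * b))) *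
          poch β (n - a - b) := by
  rw [mehlerCoeff, mehlerPoly, gammaFunctional_C_mul]
  simp only [map_sum, gammaFunctional_C_mul_X_pow]

lemma mehlerCoeff_zero (β x y : ℂ) : mehlerCoeff β x y 0 = 1 := by
  rw [mehlerCoeff, mehlerPoly_zero, gammaFunctional_one]

lemma mehlerCoeff_recurrence (β x y : ℂ) (n : ℕ) :
    (n + 4) * mehlerCoeff β x y (n + 4) - (2 * n + 5) * mehlerCoeff β x y (n + 2) +
      (n + 1) * mehlerCoeff β x y n =
    β * (2 * x * y * (mehlerCoeff (β + 1) x y (n + 3) + mehlerCoeff (β + 1) x y (n + 1)) -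
      2 * (x ^ 2 + y ^ 2) * mehlerCoeff (β + 1) x y (n + 2)) := by
  simpa only [mehlerCoeff, gammaFunctional_X_mul, gammaFunctional_C_mul, LinearMap.map_sub,
    LinearMap.map_add] using
    congrArg (gammaFunctional β) (mehlerPoly_recurrence x y n)

lemma mehlerCoeff_one (β x y : ℂ) :
    mehlerCoeff β x y 1 = β * (2 * x * y * mehlerCoeff (β + 1) x y 0) := by
  simpa only [mehlerCoeff, gammaFunctional_X_mul, gammaFunctional_C_mul] using
    congrArg (gammaFunctional β) (mehlerPoly_one x y)

lemma mehlerCoeff_two (β x y : ℂ) : 2 * mehlerCoeff β x y 2 - mehlerCoeff β x y 0 =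
    β * (2 * x * y * mehlerCoeff (β + 1) x y 1 -
      2 * (x ^ 2 + y ^ 2) * mehlerCoeff (β + 1) x y 0) := by
  simpa only [mehlerCoeff, gammaFunctional_X_mul, gammaFunctional_C_mul, LinearMap.map_sub] using
    congrArg (gammaFunctional β) (mehlerPoly_two x y)

lemma mehlerCoeff_three (β x y : ℂ) : 3 * mehlerCoeff β x y 3 - 3 * mehlerCoeff β x y 1 =
    β * (2 * x * y * (mehlerCoeff (β + 1) x y 2 + mehlerCoeff (β + 1) x y 0) -
      2 * (x ^ 2 + y ^ 2) * mehlerCoeff (β + 1) x y 1) := by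
  simpa only [mehlerCoeff, gammaFunctional_X_mul, gammaFunctional_C_mul, LinearMap.map_sub,
    LinearMap.map_add] using
    congrArg (gammaFunctional β) (mehlerPoly_three x y)

end Mehler

section KernelExpansion

open PowerSeries

lemma kernelEq_mehlerCoeff (x y : ℂ) :
    KernelEq (2 * x * y) (2 * (x ^ 2 + y ^ 2)) fun β => .mk (mehlerCoeff β x y) := by
  intro β
  have expand (F G H : PowerSeries ℂ) (S R : ℂ) : (1 - X ^ 2) ^ 2 * F = X * (1 - X ^ 2) * G +
      C β * (C S * (1 + X ^ 2) - C R * X) * H ↔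
      F - C 2 * (X ^ 2 * F) + X ^ 4 * F =
        X ^ 1 * G - X ^ 3 * G + C β * (C S * (H + X ^ 2 * H) - C R * (X ^ 1 * H)) := by
    rw [map_ofNat]
    ring_nf
  rw [expand]
  ext n
  simp only [map_add, map_sub, coeff_C_mul, coeff_X_pow_mul', coeff_derivative, coeff_mk]
  match n with
  | 0 =>
    norm_num
    linear_combination mehlerCoeff_one β x y
  | 1 =>
    norm_num
    linear_combination mehlerCoeff_two β x y
  | 2 =>
    norm_num
    linear_combination mehlerCoeff_three β x y
  | 3 =>
    have recurrence := mehlerCoeff_recurrence β x y 0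
    norm_num at recurrence ⊢
    linear_combination recurrence
  | n + 4 =>
    have recurrence := mehlerCoeff_recurrence β x y (n + 1)
    simp only [if_pos (show 4 ≤ n + 4 by lia), if_pos (show 3 ≤ n + 4 by lia),
      if_pos (show 2 ≤ n + 4 by lia), if_pos (show 1 ≤ n + 4 by lia), Nat.add_sub_cancel,
      show n + 4 - 1 = n + 3 by lia, show n + 4 - 2 = n + 2 by lia,
      show n + 4 - 3 = n + 1 by lia]
    push_cast at recurrence ⊢
    linear_combination recurrence

lemma kernelSeries_eq_mk_mehlerCoeff {x y u v : ℂ} (h_add : u + v = 2 * x * y)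
    (h_mul : u * v = x ^ 2 + y ^ 2 - 1) (β : ℂ) :
    kernelSeries u v β = .mk (mehlerCoeff β x y) := by
  have kernelEq := kernelEq_kernelSeries u v
  rw [h_add, h_mul, sub_add_cancel] at kernelEq
  refine kernelEq.unique (kernelEq_mehlerCoeff x y) (fun β => ?_) β
  have mehler_const : constantCoeff (PowerSeries.mk (mehlerCoeff β x y)) = 1 := by
    rw [← coeff_zero_eq_constantCoeff_apply, coeff_mk, mehlerCoeff_zero]
  rw [mehler_const]
  simp [kernelSeries, constantCoeff_binSeries]

end KernelExpansion

section Convergence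

open Finset PowerSeries

/-- The terms of `φ` at radius `T` are dominated by the summable sequence `F`. The majorant is
kept explicit so that one majorant can serve a whole family of series. -/
def DominatedBy (φ : PowerSeries ℂ) (T : ℝ) (F : ℕ → ℝ) : Prop :=
  Summable F ∧ ∀ n, ‖coeff n φ‖ * T ^ n ≤ F n

lemma DominatedBy.summable_norm {φ : PowerSeries ℂ} {t : ℂ} {F : ℕ → ℝ}
    (h : DominatedBy φ ‖t‖ F) : Summable fun n => ‖coeff n φ * t ^ n‖ :=
  h.1.of_nonneg_of_le (fun _ => norm_nonneg _) fun n => by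
    rw [norm_mul, norm_pow]
    exact h.2 n

lemma DominatedBy.nonneg {φ : PowerSeries ℂ} {T : ℝ} {F : ℕ → ℝ} (hT : 0 ≤ T)
    (h : DominatedBy φ T F) (n : ℕ) : 0 ≤ F n :=
  le_trans (by positivity) (h.2 n)

lemma DominatedBy.mul {φ ψ : PowerSeries ℂ} {T : ℝ} {F G : ℕ → ℝ} (hT : 0 ≤ T)
    (hφ : DominatedBy φ T F) (hψ : DominatedBy ψ T G) :
    DominatedBy (φ * ψ) T fun n => ∑ ij ∈ antidiagonal n, F ij.1 * G ij.2 := by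
  refine ⟨summable_sum_mul_antidiagonal_of_summable_mul
    (hφ.1.mul_of_nonneg hψ.1 (hφ.nonneg hT) (hψ.nonneg hT)), fun n => ?_⟩
  rw [coeff_mul]
  calc ‖∑ ij ∈ antidiagonal n, coeff ij.1 φ * coeff ij.2 ψ‖ * T ^ n
      ≤ (∑ ij ∈ antidiagonal n, ‖coeff ij.1 φ * coeff ij.2 ψ‖) * T ^ n := by
        gcongr
        exact norm_sum_le _ _
    _ = ∑ ij ∈ antidiagonal n, (‖coeff ij.1 φ‖ * T ^ ij.1) * (‖coeff ij.2 ψ‖ * T ^ ij.2) := by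
        rw [sum_mul]
        refine sum_congr rfl fun ij hij => ?_
        rw [norm_mul, ← HasAntidiagonal.mem_antidiagonal.mp hij, pow_add]
        ring
    _ ≤ ∑ ij ∈ antidiagonal n, F ij.1 * G ij.2 :=
        sum_le_sum fun ij _ => mul_le_mul (hφ.2 _) (hψ.2 _) (by positivity) (hφ.nonneg hT _)

lemma hasSum_coeff_mul {φ ψ : PowerSeries ℂ} {t a b : ℂ}
    (hφ : Summable fun n => ‖coeff n φ * t ^ n‖) (hψ : Summable fun n => ‖coeff n ψ * t ^ n‖)
    (ha : HasSum (fun n => coeff n φ * t ^ n) a) (hb : HasSum (fun n => coeff n ψ * t ^ n) b) :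
    HasSum (fun n => coeff n (φ * ψ) * t ^ n) (a * b) := by
  have cauchy_product (n : ℕ) : coeff n (φ * ψ) * t ^ n =
      ∑ ij ∈ antidiagonal n, (coeff ij.1 φ * t ^ ij.1) * (coeff ij.2 ψ * t ^ ij.2) := by
    rw [coeff_mul, sum_mul]
    refine sum_congr rfl fun ij hij => ?_
    rw [← HasAntidiagonal.mem_antidiagonal.mp hij, pow_add]
    ring
  simp only [cauchy_product]
  rw [← ha.tsum_eq, ← hb.tsum_eq, tsum_mul_tsum_eq_tsum_sum_antidiagonal_of_summable_norm hφ hψ]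
  exact (summable_norm_sum_mul_antidiagonal_of_summable_norm hφ hψ).of_norm.hasSum

lemma hasSum_poch_div (c : ℂ) {z : ℂ} (hz : ‖z‖ < 1) :
    HasSum (fun n => poch c n / (n.factorial : ℂ) * z ^ n) ((1 - z) ^ (-c)) := by
  have binomial_series := (Complex.one_div_one_sub_cpow_hasFPowerSeriesOnBall_zero c).hasSum
    (y := z) (by simpa [Metric.mem_eball, ← ofReal_norm] using hz)
  simpa [FormalMultilinearSeries.ofScalars_apply_eq, ← Ring.multichoose_eq,
    multichoose_eq_poch_div_factorial, Complex.cpow_neg, mul_comm]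
    using binomial_series

lemma summable_norm_poch_div (c : ℂ) {T : ℝ} (hT₀ : 0 ≤ T) (hT : T < 1) :
    Summable fun n => ‖poch c n / (n.factorial : ℂ)‖ * T ^ n := by
  have summable : Summable fun n => poch c n / (n.factorial : ℂ) * (T : ℂ) ^ n :=
    (hasSum_poch_div c (by simpa [abs_of_nonneg hT₀] using hT)).summable
  simpa [abs_of_nonneg hT₀] using summable.norm

lemma dominatedBy_binSeries (c : ℂ) {w : ℂ} (hw : ‖w‖ ≤ 1) {T : ℝ} (hT₀ : 0 ≤ T) (hT : T < 1) :
    DominatedBy (binSeries c w) T fun n => ‖poch c n / (n.factorial : ℂ)‖ * T ^ n := by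
  refine ⟨summable_norm_poch_div c hT₀ hT, fun n => ?_⟩
  rw [coeff_binSeries, norm_mul, norm_pow]
  exact mul_le_mul_of_nonneg_right
    (mul_le_of_le_one_right (norm_nonneg _) (pow_le_one₀ (norm_nonneg _) hw)) (by positivity)

lemma hasSum_binSeries (c : ℂ) {w t : ℂ} (hw : ‖w‖ ≤ 1) (ht : ‖t‖ < 1) :
    HasSum (fun n => coeff n (binSeries c w) * t ^ n) ((1 - w * t) ^ (-c)) := by
  have norm_lt : ‖w * t‖ < 1 := by
    rw [norm_mul]
    exact (mul_le_of_le_one_left (norm_nonneg _) hw).trans_lt ht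
  simpa only [coeff_binSeries, mul_pow, mul_assoc] using hasSum_poch_div c norm_lt

lemma exists_dominatedBy_kernelSeries (β : ℂ) {T : ℝ} (hT₀ : 0 ≤ T) (hT : T < 1) :
    ∃ F : ℕ → ℝ, ∀ u v : ℂ, ‖u‖ ≤ 1 → ‖v‖ ≤ 1 → DominatedBy (kernelSeries u v β) T F :=
  ⟨_, fun _ _ hu hv => (((dominatedBy_binSeries _ (by simp) hT₀ hT).mul hT₀
    (dominatedBy_binSeries _ (by simp) hT₀ hT)).mul hT₀
    (dominatedBy_binSeries _ hu hT₀ hT)).mul hT₀ (dominatedBy_binSeries _ hv hT₀ hT)⟩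

lemma hasSum_kernelSeries (β : ℂ) {u v t : ℂ} (hu : ‖u‖ ≤ 1) (hv : ‖v‖ ≤ 1) (ht : ‖t‖ < 1) :
    HasSum (fun n => coeff n (kernelSeries u v β) * t ^ n)
      ((1 - t) ^ (-(1 / 2 - β)) * (1 + t) ^ (-(1 / 2 - β)) * (1 - u * t) ^ (-β) *
        (1 - v * t) ^ (-β)) := by
  have ht₀ := norm_nonneg t
  have dom_one := dominatedBy_binSeries (1 / 2 - β) (w := 1) (by simp) ht₀ ht
  have dom_neg_one := dominatedBy_binSeries (1 / 2 - β) (w := -1) (by simp) ht₀ ht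
  have dom_u := dominatedBy_binSeries β hu ht₀ ht
  have dom_v := dominatedBy_binSeries β hv ht₀ ht
  have dom_half := dom_one.mul ht₀ dom_neg_one
  have sum_half := hasSum_coeff_mul dom_one.summable_norm dom_neg_one.summable_norm
    (hasSum_binSeries _ (by simp) ht) (hasSum_binSeries _ (by simp) ht)
  have sum_half_u := hasSum_coeff_mul dom_half.summable_norm dom_u.summable_norm sum_half
    (hasSum_binSeries _ hu ht)
  simpa [kernelSeries] using hasSum_coeff_mul (dom_half.mul ht₀ dom_u).summable_norm
    dom_v.summable_norm sum_half_u (hasSum_binSeries _ hv ht)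

lemma exists_kernel_params {x y : ℝ} (hx : x ^ 2 ≤ 1) (hy : y ^ 2 ≤ 1) :
    ∃ u v : ℝ, |u| ≤ 1 ∧ |v| ≤ 1 ∧ u + v = 2 * x * y ∧ u * v = x ^ 2 + y ^ 2 - 1 := by
  have sq_a := Real.sq_sqrt (sub_nonneg.mpr hx)
  have sq_b := Real.sq_sqrt (sub_nonneg.mpr hy)
  set a := √(1 - x ^ 2)
  set b := √(1 - y ^ 2)
  refine ⟨x * y + a * b, x * y - a * b, ?_, ?_, by ring, ?_⟩
  · rw [← sq_le_one_iff_abs_le_one]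
    nlinarith [sq_nonneg (x * b - a * y)]
  · rw [← sq_le_one_iff_abs_le_one]
    nlinarith [sq_nonneg (x * b + a * y)]
  · linear_combination -(b ^ 2) * sq_a - (1 - x ^ 2) * sq_b

lemma Lam_eq (α : ℝ) {x y u v : ℝ} (h_add : u + v = 2 * x * y)
    (h_mul : u * v = x ^ 2 + y ^ 2 - 1) :
    Lam α x y = Real.cosh α ^ 2 * ((1 - u * Real.tanh α) * (1 - v * Real.tanh α)) := by
  have cosh_ne : Real.cosh α ≠ 0 := (Real.cosh_pos α).ne'
  rw [Lam, Real.tanh_eq_sinh_div_cosh]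
  field_simp
  linear_combination (Real.sinh α * Real.cosh α) * h_add - Real.sinh α ^ 2 * h_mul -
    Real.cosh_sq α

lemma one_sub_mul_pos {w t : ℝ} (hw : |w| ≤ 1) (ht : |t| < 1) : 0 < 1 - w * t := by
  have abs_lt_one : |w * t| < 1 := by
    rw [abs_mul]
    exact (mul_le_of_le_one_left (abs_nonneg _) hw).trans_lt ht
  linarith [(abs_lt.mp abs_lt_one).2]

lemma one_sub_tanh_cpow_mul_one_add_tanh_cpow (c : ℂ) (α : ℝ) :
    (1 - (Real.tanh α : ℂ)) ^ (-(1 / 2 + c)) * (1 + (Real.tanh α : ℂ)) ^ (-(1 / 2 + c)) =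
      (Real.cosh α : ℂ) * ((Real.cosh α ^ 2 : ℝ) : ℂ) ^ c := by
  have cosh_pos := Real.cosh_pos α
  obtain ⟨neg_one_lt, lt_one⟩ := abs_lt.mp (Real.abs_tanh_lt_one α)
  have tanh_product : (1 - Real.tanh α) * (1 + Real.tanh α) = (Real.cosh α ^ 2)⁻¹ := by
    rw [Real.tanh_eq_sinh_div_cosh]
    field_simp
    linear_combination Real.cosh_sq α
  have cosh_eq : ((Real.cosh α ^ 2 : ℝ) : ℂ) ^ (1 / 2 : ℂ) = Real.cosh α := by
    have sqrt_eq := Complex.ofReal_cpow (sq_nonneg (Real.cosh α)) (1 / 2)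
    rw [← Real.sqrt_eq_rpow, Real.sqrt_sq cosh_pos.le] at sqrt_eq
    push_cast at sqrt_eq ⊢
    exact sqrt_eq.symm
  have sq_ne_zero : ((Real.cosh α ^ 2 : ℝ) : ℂ) ≠ 0 := mod_cast (pow_pos cosh_pos 2).ne'
  have arg_ne_pi : ((Real.cosh α ^ 2 : ℝ) : ℂ).arg ≠ Real.pi := by
    rw [Complex.arg_ofReal_of_nonneg (by positivity)]
    exact Real.pi_pos.ne
  rw [← Complex.ofReal_one, ← Complex.ofReal_sub, ← Complex.ofReal_add,
    ← Complex.mul_cpow_ofReal_nonneg (by linarith) (by linarith), ← Complex.ofReal_mul,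
    tanh_product, Complex.ofReal_inv, Complex.inv_cpow _ _ arg_ne_pi, ← Complex.cpow_neg, neg_neg,
    Complex.ofReal_one, Complex.cpow_add _ _ sq_ne_zero, cosh_eq]

lemma LamPow_eq (σ : ℂ) (α : ℝ) {x y u v : ℝ} (hu : |u| ≤ 1) (hv : |v| ≤ 1)
    (h_add : u + v = 2 * x * y) (h_mul : u * v = x ^ 2 + y ^ 2 - 1) :
    LamPow σ α x y = ((Real.cosh α ^ 2 : ℝ) : ℂ) ^ (σ / 2) *
      ((1 - (u : ℂ) * (Real.tanh α : ℂ)) ^ (σ / 2) *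
        (1 - (v : ℂ) * (Real.tanh α : ℂ)) ^ (σ / 2)) := by
  have u_pos := one_sub_mul_pos hu (Real.abs_tanh_lt_one α)
  have v_pos := one_sub_mul_pos hv (Real.abs_tanh_lt_one α)
  rw [LamPow, Lam_eq α h_add h_mul, Complex.ofReal_mul,
    Complex.mul_cpow_ofReal_nonneg (by positivity) (mul_pos u_pos v_pos).le, Complex.ofReal_mul,
    Complex.mul_cpow_ofReal_nonneg u_pos.le v_pos.le]
  norm_cast

lemma hasSum_mehlerCoeff (σ : ℂ) (α : ℝ) {x y : ℝ} (hx : x ^ 2 ≤ 1) (hy : y ^ 2 ≤ 1) :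
    HasSum (fun n => mehlerCoeff (-σ / 2) x y n * (Real.tanh α : ℂ) ^ n)
      ((Real.cosh α : ℂ) * LamPow σ α x y) := by
  obtain ⟨u, v, hu, hv, h_add, h_mul⟩ := exists_kernel_params hx hy
  have kernel_sum := hasSum_kernelSeries (-σ / 2) (u := (u : ℂ)) (v := (v : ℂ))
    (t := (Real.tanh α : ℂ)) (by simpa using hu) (by simpa using hv)
    (by rw [Complex.norm_real]; exact Real.abs_tanh_lt_one α)
  have kernel_eq := kernelSeries_eq_mk_mehlerCoeff (x := (x : ℂ)) (y := y) (u := u) (v := v)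
    (mod_cast h_add) (mod_cast h_mul) (-σ / 2)
  simp only [kernel_eq, coeff_mk] at kernel_sum
  rw [LamPow_eq σ α hu hv h_add h_mul, ← mul_assoc, ← mul_assoc,
    ← one_sub_tanh_cpow_mul_one_add_tanh_cpow]
  convert kernel_sum using 4 <;> ring_nf

lemma exists_bound_mehlerCoeff (β : ℂ) {t : ℝ} (ht : |t| < 1) :
    ∃ F : ℕ → ℝ, Summable F ∧ ∀ x y : ℝ, x ^ 2 ≤ 1 → y ^ 2 ≤ 1 → ∀ n,
      ‖mehlerCoeff β x y n * (t : ℂ) ^ n‖ ≤ F n := by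
  obtain ⟨F, hF⟩ := exists_dominatedBy_kernelSeries β (abs_nonneg t) ht
  refine ⟨F, (hF 1 1 (by simp) (by simp)).1, fun x y hx hy n => ?_⟩
  obtain ⟨u, v, hu, hv, h_add, h_mul⟩ := exists_kernel_params hx hy
  have bound := (hF u v (by simpa using hu) (by simpa using hv)).2 n
  rw [kernelSeries_eq_mk_mehlerCoeff (x := (x : ℂ)) (y := y) (mod_cast h_add) (mod_cast h_mul),
    coeff_mk] at bound
  simpa using bound

end Convergence

section Moments

open Finset intervalIntegral

/-- The shape shared by the moments of the Gegenbauer weights, of the exponentials on the circle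
and of the two-point sphere: the moments vanish unless `k = l + 2i`, and then they are
`K (l + 2i)! / (4^i i! (c)_i)`. -/
structure HasMoments {𝕜 : Type*} [Field 𝕜] (M : ℕ → 𝕜) (K c : 𝕜) (l : ℕ) : Prop where
  apply_add_two_mul (i : ℕ) : M (l + 2 * i) =
    K * (((l + 2 * i).factorial : 𝕜) / (4 ^ i * (i.factorial : 𝕜) * (ascPochhammer 𝕜 i).eval c))
  eq_zero (k : ℕ) (hk : ∀ i, k ≠ l + 2 * i) : M k = 0

lemma HasMoments.apply_eq_poch {M : ℕ → ℂ} {K c : ℂ} {l : ℕ} (h : HasMoments M K c l) (i : ℕ) :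
    M (l + 2 * i) =
      K * (((l + 2 * i).factorial : ℂ) / (4 ^ i * (i.factorial : ℂ) * poch c i)) :=
  h.apply_add_two_mul i

lemma HasMoments.ofReal {M : ℕ → ℝ} {K c : ℝ} {l : ℕ} (h : HasMoments M K c l) :
    HasMoments (fun k => (M k : ℂ)) K c l := by
  refine ⟨fun i => ?_, fun k hk => by rw [h.eq_zero k hk, Complex.ofReal_zero]⟩
  rw [h.apply_add_two_mul, ← poch, poch_ofReal]
  push_cast
  rfl

lemma HasMoments.const_mul {𝕜 : Type*} [Field 𝕜] {M : ℕ → 𝕜} {K c : 𝕜} {l : ℕ}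
    (h : HasMoments M K c l) (a : 𝕜) : HasMoments (fun k => a * M k) (a * K) c l :=
  ⟨fun i => by rw [h.apply_add_two_mul, mul_assoc a],
    fun k hk => by rw [h.eq_zero k hk, mul_zero]⟩

lemma ascPochhammer_eval_succ_left {R : Type*} [CommSemiring R] (a : R) (n : ℕ) :
    (ascPochhammer R (n + 1)).eval a = a * (ascPochhammer R n).eval (a + 1) := by
  simp [ascPochhammer_succ_left]

lemma HasMoments.shift {M : ℕ → ℝ} {K c : ℝ} (hc : 0 < c) (h : HasMoments M K c 0) :
    HasMoments (fun k => M (k + 1)) (K / (2 * c)) (c + 1) 1 := by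
  refine ⟨fun i => ?_, fun k hk => h.eq_zero _ fun i hi => hk (i - 1) (by lia)⟩
  have := (ascPochhammer_pos i (c + 1) (by linarith)).ne'
  rw [show 1 + 2 * i + 1 = 0 + 2 * (i + 1) by ring, h.apply_add_two_mul,
    ascPochhammer_eval_succ_left, show 0 + 2 * (i + 1) = (1 + 2 * i) + 1 by ring,
    Nat.factorial_succ (1 + 2 * i), Nat.factorial_succ i]
  push_cast
  field_simp
  ring

/-- The moments of the weight `(1 - x²)^e`. -/
def weightMoment (e : ℝ) (k : ℕ) : ℝ := ∫ x in (-1 : ℝ)..1, x ^ k * (1 - x ^ 2) ^ e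

lemma continuous_one_sub_sq_rpow {e : ℝ} (he : 0 ≤ e) :
    Continuous fun x : ℝ => (1 - x ^ 2) ^ e :=
  Continuous.rpow_const (by fun_prop) fun _ => Or.inr he

lemma weightMoment_of_odd (e : ℝ) {k : ℕ} (hk : Odd k) : weightMoment e k = 0 := by
  have reflection := integral_comp_neg (a := -1) (b := 1) fun x : ℝ => x ^ k * (1 - x ^ 2) ^ e
  simp only [hk.neg_pow, neg_sq, neg_neg, neg_mul, integral_neg] at reflection
  rw [weightMoment]
  linarith

lemma one_sub_sq_rpow_add_one {e x : ℝ} (he : 0 ≤ e) (hx : x ∈ Set.uIcc (-1 : ℝ) 1) :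
    (1 - x ^ 2) ^ (e + 1) = (1 - x ^ 2) ^ e * (1 - x ^ 2) := by
  rw [Set.uIcc_of_le (by norm_num)] at hx
  rw [Real.rpow_add_of_nonneg (by nlinarith [hx.1, hx.2]) he zero_le_one, Real.rpow_one]

lemma weightMoment_add_one {e : ℝ} (he : 0 ≤ e) (k : ℕ) :
    weightMoment (e + 1) k = weightMoment e k - weightMoment e (k + 2) := by
  have := continuous_one_sub_sq_rpow he
  rw [weightMoment, weightMoment, weightMoment, ← integral_sub
    (Continuous.intervalIntegrable (by fun_prop) _ _)
    (Continuous.intervalIntegrable (by fun_prop) _ _)]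
  refine integral_congr fun x hx => ?_
  simp only [one_sub_sq_rpow_add_one he hx]
  ring

lemma hasDerivAt_pow_mul_one_sub_sq_rpow {e : ℝ} (he : 0 ≤ e) (k : ℕ) (x : ℝ) :
    HasDerivAt (fun x : ℝ => x ^ (k + 1) * (1 - x ^ 2) ^ (e + 1))
      ((k + 1) * (x ^ k * (1 - x ^ 2) ^ (e + 1)) -
        2 * (e + 1) * (x ^ (k + 2) * (1 - x ^ 2) ^ e)) x := by
  have base_deriv : HasDerivAt (fun x : ℝ => 1 - x ^ 2) (-(2 * x)) x := by
    simpa using (hasDerivAt_pow 2 x).const_sub 1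
  refine ((hasDerivAt_pow (k + 1) x).mul
    (base_deriv.rpow_const (p := e + 1) (Or.inr (by linarith)))).congr_deriv ?_
  rw [add_tsub_cancel_right, add_sub_cancel_right]
  push_cast
  ring

lemma weightMoment_recurrence {e : ℝ} (he : 0 ≤ e) (k : ℕ) :
    ((k : ℝ) + 2 * e + 3) * weightMoment e (k + 2) = (k + 1) * weightMoment e k := by
  have := continuous_one_sub_sq_rpow he
  have := continuous_one_sub_sq_rpow (e := e + 1) (by linarith)
  have zero_rpow : (0 : ℝ) ^ (e + 1) = 0 := Real.zero_rpow (by linarith)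
  have by_parts := integral_eq_sub_of_hasDerivAt (a := -1) (b := 1)
    (fun x _ => hasDerivAt_pow_mul_one_sub_sq_rpow he k x)
    (Continuous.intervalIntegrable (by fun_prop) _ _)
  rw [integral_sub (Continuous.intervalIntegrable (by fun_prop) _ _)
    (Continuous.intervalIntegrable (by fun_prop) _ _), integral_const_mul, integral_const_mul,
    ← weightMoment, ← weightMoment, weightMoment_add_one he] at by_parts
  norm_num [zero_rpow] at by_parts
  linarith

lemma weightMoment_zero (n : ℕ) :
    weightMoment ((n : ℝ) / 2) 0 =
      √Real.pi * Real.Gamma ((n : ℝ) / 2 + 1) / Real.Gamma ((n : ℝ) / 2 + 3 / 2) := by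
  have Gamma_three_half : Real.Gamma (3 / 2) = √Real.pi / 2 := by
    rw [show (3 / 2 : ℝ) = 1 / 2 + 1 by norm_num, Real.Gamma_add_one (by norm_num),
      Real.Gamma_one_half_eq]
    ring
  induction n using Nat.twoStepInduction with
  | zero =>
    have : √Real.pi ≠ 0 := (Real.sqrt_pos.mpr Real.pi_pos).ne'
    simp only [weightMoment, Nat.cast_zero, zero_div, Real.rpow_zero, zero_add, Gamma_three_half,
      Real.Gamma_one]
    norm_num
    field_simp
  | one =>
    rw [show ((1 : ℕ) : ℝ) / 2 + 1 = 3 / 2 by norm_num,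
      show ((1 : ℕ) : ℝ) / 2 + 3 / 2 = 1 + 1 by norm_num, Gamma_three_half,
      Real.Gamma_add_one one_ne_zero, Real.Gamma_one]
    simp only [weightMoment, Nat.cast_one, ← Real.sqrt_eq_rpow, pow_zero, one_mul,
      integral_sqrt_one_sub_sq, div_one]
    nlinarith [Real.sq_sqrt Real.pi_pos.le]
  | more n ih _ =>
    have he : (0 : ℝ) ≤ (n : ℝ) / 2 := by positivity
    have : Real.Gamma ((n : ℝ) / 2 + 3 / 2) ≠ 0 := (Real.Gamma_pos_of_pos (by positivity)).ne'
    have moment_two : weightMoment ((n : ℝ) / 2) 2 = weightMoment ((n : ℝ) / 2) 0 / (n + 3) := by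
      have recurrence := weightMoment_recurrence he 0
      rw [eq_div_iff (by positivity)]
      simp only [Nat.cast_zero, zero_add] at recurrence
      linear_combination recurrence
    rw [show ((n + 2 : ℕ) : ℝ) / 2 = (n : ℝ) / 2 + 1 by push_cast; ring, weightMoment_add_one he,
      show (n : ℝ) / 2 + 1 + 3 / 2 = (n : ℝ) / 2 + 3 / 2 + 1 by ring,
      Real.Gamma_add_one (s := (n : ℝ) / 2 + 1) (by positivity),
      Real.Gamma_add_one (s := (n : ℝ) / 2 + 3 / 2) (by positivity), zero_add, moment_two, ih]
    field_simp
    ring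

lemma hasMoments_weightMoment {e : ℝ} (he : 0 ≤ e) :
    HasMoments (weightMoment e) (weightMoment e 0) (e + 3 / 2) 0 := by
  refine ⟨fun i => ?_, fun k hk => weightMoment_of_odd e ?_⟩
  · rw [zero_add]
    induction i with
    | zero => simp
    | succ i ih =>
      have := (ascPochhammer_pos i (e + 3 / 2) (by linarith)).ne'
      have : e + 3 / 2 + i ≠ 0 := by positivity
      have step : weightMoment e (2 * i + 2) =
          (2 * i + 1) * weightMoment e (2 * i) / (2 * i + 2 * e + 3) := by
        rw [eq_div_iff (by positivity)]
        have recurrence := weightMoment_recurrence he (2 * i)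
        push_cast at recurrence
        linear_combination recurrence
      rw [show 2 * (i + 1) = 2 * i + 1 + 1 by ring, step, ih, ascPochhammer_succ_eval,
        Nat.factorial_succ (2 * i + 1), Nat.factorial_succ (2 * i), Nat.factorial_succ i]
      push_cast
      field_simp
      ring
  · rw [← Nat.not_even_iff_odd]
    rintro ⟨i, hi⟩
    exact hk i (by lia)

/-- The coefficient of `(2x)^(n - 2k)` in `C_n^κ(x)`. -/
def gegenbauerCoeff (κ : ℝ) (n k : ℕ) : ℝ :=
  (-1) ^ k * (ascPochhammer ℝ (n - k)).eval κ / ((k.factorial : ℝ) * ((n - 2 * k).factorial : ℝ))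

lemma gegenbauer_eq (n : ℕ) (κ x : ℝ) : gegenbauer n κ x =
    ∑ k ∈ range (n / 2 + 1), gegenbauerCoeff κ n k * (2 * x) ^ (n - 2 * k) := rfl

lemma gegenbauer_zero (κ x : ℝ) : gegenbauer 0 κ x = 1 := by simp [gegenbauer]

lemma gegenbauer_one (κ x : ℝ) : gegenbauer 1 κ x = 2 * κ * x := by
  simp [gegenbauer]
  ring

lemma gegenbauerCoeff_add_two_zero (κ : ℝ) (n : ℕ) :
    ((n : ℝ) + 2) * gegenbauerCoeff κ (n + 2) 0 =
      (n + 1 + κ) * gegenbauerCoeff κ (n + 1) 0 := by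
  simp only [gegenbauerCoeff, mul_zero, tsub_zero, Nat.factorial_succ (n + 1), pow_zero,
    ascPochhammer_succ_eval (n + 1)]
  push_cast
  field_simp
  ring

lemma gegenbauerCoeff_add_two_succ (κ : ℝ) {n k : ℕ} (hk : 2 * k + 1 ≤ n) :
    ((n : ℝ) + 2) * gegenbauerCoeff κ (n + 2) (k + 1) =
      (n + 1 + κ) * gegenbauerCoeff κ (n + 1) (k + 1) -
        (n + 2 * κ) * gegenbauerCoeff κ n k := by
  obtain ⟨m, rfl⟩ := Nat.exists_eq_add_of_le hk
  simp only [gegenbauerCoeff, show 2 * k + 1 + m + 2 - 2 * (k + 1) = m + 1 by lia,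
    show 2 * k + 1 + m + 1 - 2 * (k + 1) = m by lia,
    show 2 * k + 1 + m - 2 * k = m + 1 by lia,
    show 2 * k + 1 + m + 2 - (k + 1) = k + m + 1 + 1 by lia,
    show 2 * k + 1 + m + 1 - (k + 1) = k + m + 1 by lia,
    show 2 * k + 1 + m - k = k + m + 1 by lia,
    Nat.factorial_succ, ascPochhammer_succ_eval (k + m + 1)]
  push_cast
  field_simp
  ring

lemma gegenbauerCoeff_two_mul_add_two (κ : ℝ) (k : ℕ) :
    ((2 * k : ℕ) + 2 : ℝ) * gegenbauerCoeff κ (2 * k + 2) (k + 1) =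
      -(((2 * k : ℕ) + 2 * κ) * gegenbauerCoeff κ (2 * k) k) := by
  simp only [gegenbauerCoeff, show 2 * k + 2 - 2 * (k + 1) = 0 by lia,
    show 2 * k + 2 - (k + 1) = k + 1 by lia, show 2 * k - k = k by lia, Nat.factorial_succ,
    Nat.sub_self, ascPochhammer_succ_eval]
  push_cast
  field_simp
  ring

lemma gegenbauer_recurrence (n : ℕ) (κ x : ℝ) :
    ((n : ℝ) + 2) * gegenbauer (n + 2) κ x =
      (n + 1 + κ) * (2 * x) * gegenbauer (n + 1) κ x - (n + 2 * κ) * gegenbauer n κ x := by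
  simpa only [gegenbauer_eq] using sum_range_half_recurrence (gegenbauerCoeff κ) (2 * x) n
    ((n : ℝ) + 2) (n + 1 + κ) (n + 2 * κ) (gegenbauerCoeff_add_two_zero κ n)
    (fun _ => gegenbauerCoeff_add_two_succ κ)
    (by rintro k rfl; exact gegenbauerCoeff_two_mul_add_two κ k)

lemma continuous_gegenbauer (n : ℕ) (κ : ℝ) : Continuous (gegenbauer n κ) := by
  unfold gegenbauer
  fun_prop

/-- The moments of `C_l^κ` with respect to the weight `(1 - x²)^{κ - 1/2}`. -/
def gegenbauerMoment (κ : ℝ) (l k : ℕ) : ℝ :=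
  ∫ x in (-1 : ℝ)..1, x ^ k * gegenbauer l κ x * (1 - x ^ 2) ^ (κ - 1 / 2)

lemma gegenbauerMoment_zero (κ : ℝ) : gegenbauerMoment κ 0 = weightMoment (κ - 1 / 2) := by
  funext k
  simp only [gegenbauerMoment, gegenbauer_zero, mul_one, weightMoment]

lemma gegenbauerMoment_one (κ : ℝ) :
    gegenbauerMoment κ 1 = fun k => 2 * κ * weightMoment (κ - 1 / 2) (k + 1) := by
  funext k
  simp only [gegenbauerMoment, gegenbauer_one, weightMoment, ← integral_const_mul]
  congr 1
  funext x
  ring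

lemma gegenbauerMoment_recurrence {κ : ℝ} (hκ : 1 / 2 ≤ κ) (l k : ℕ) :
    ((l : ℝ) + 2) * gegenbauerMoment κ (l + 2) k =
      2 * (l + κ + 1) * gegenbauerMoment κ (l + 1) (k + 1) -
        (l + 2 * κ) * gegenbauerMoment κ l k := by
  have := continuous_one_sub_sq_rpow (e := κ - 1 / 2) (by linarith)
  have := fun m => continuous_gegenbauer m κ
  simp only [gegenbauerMoment]
  rw [← integral_const_mul, ← integral_const_mul, ← integral_const_mul,
    ← integral_sub (Continuous.intervalIntegrable (by fun_prop) _ _)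
      (Continuous.intervalIntegrable (by fun_prop) _ _)]
  refine integral_congr fun x _ => ?_
  linear_combination (x ^ k * (1 - x ^ 2) ^ (κ - 1 / 2)) * gegenbauer_recurrence l κ x

/-- The ratio between the moments of `C_l^κ` and their standard form. -/
def gegenbauerConst (κ : ℝ) (l : ℕ) : ℝ := weightMoment (κ - 1 / 2) 0 *
  ((ascPochhammer ℝ l).eval (2 * κ) /
    (2 ^ l * (l.factorial : ℝ) * (ascPochhammer ℝ l).eval (κ + 1)))

lemma gegenbauerConst_zero (κ : ℝ) : gegenbauerConst κ 0 = weightMoment (κ - 1 / 2) 0 := by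
  simp [gegenbauerConst]

lemma gegenbauerConst_succ (κ : ℝ) (l : ℕ) : gegenbauerConst κ (l + 1) =
    gegenbauerConst κ l * (l + 2 * κ) / (2 * (l + 1) * (l + κ + 1)) := by
  simp only [gegenbauerConst, ascPochhammer_succ_eval, Nat.factorial_succ]
  rw [show κ + 1 + (l : ℝ) = l + κ + 1 by ring, show 2 * κ + (l : ℝ) = l + 2 * κ by ring,
    mul_div_assoc (weightMoment _ _ * _), mul_assoc (weightMoment _ _), div_mul_div_comm]
  push_cast
  congr 2
  ring

lemma HasMoments.of_recurrence {M₀ M₁ M₂ : ℕ → ℝ} {K c : ℝ} {l : ℕ} (hc : 0 < c)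
    (h₀ : HasMoments M₀ K c l)
    (h₁ : HasMoments M₁ (K * (2 * c - l - 2) / (2 * (l + 1) * c)) (c + 1) (l + 1))
    (h_rec : ∀ k, ((l : ℝ) + 2) * M₂ k = 2 * c * M₁ (k + 1) - (2 * c - l - 2) * M₀ k) :
    HasMoments M₂ (K * (2 * c - l - 2) / (2 * (l + 1) * c) *
      (2 * c - l - 1) / (2 * (l + 2) * (c + 1))) (c + 2) (l + 2) := by
  have solve_rec (k : ℕ) : M₂ k = (2 * c * M₁ (k + 1) - (2 * c - l - 2) * M₀ k) / (l + 2) := by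
    rw [eq_div_iff (by positivity), mul_comm, h_rec]
  refine ⟨fun i => ?_, fun k hk => ?_⟩
  · have := (ascPochhammer_pos i (c + 1 + 1) (by linarith)).ne'
    have shift_eval : (ascPochhammer ℝ i).eval (c + 1) =
        (c + 1) * (ascPochhammer ℝ i).eval (c + 1 + 1) / (c + 1 + i) := by
      rw [eq_div_iff (by positivity), ← ascPochhammer_eval_succ_left, ascPochhammer_succ_eval]
    rw [solve_rec, show l + 2 + 2 * i + 1 = l + 1 + 2 * (i + 1) by ring, h₁.apply_add_two_mul,
      show l + 2 + 2 * i = l + 2 * (i + 1) by ring, h₀.apply_add_two_mul,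
      show c + 2 = c + 1 + 1 by ring, ascPochhammer_eval_succ_left c,
      ascPochhammer_eval_succ_left (c + 1), shift_eval,
      show l + 1 + 2 * (i + 1) = l + 2 * (i + 1) + 1 by ring,
      Nat.factorial_succ (l + 2 * (i + 1)), Nat.factorial_succ i]
    push_cast
    field_simp
    ring
  · rw [solve_rec]
    obtain rfl | k_ne := eq_or_ne k l
    · have moment₀ := h₀.apply_add_two_mul 0
      have moment₁ := h₁.apply_add_two_mul 0
      simp only [mul_zero, add_zero, pow_zero, Nat.factorial_zero, ascPochhammer_zero,
        Polynomial.eval_one, Nat.cast_one, mul_one, div_one] at moment₀ moment₁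
      rw [moment₀, moment₁, Nat.factorial_succ]
      push_cast
      field_simp
      ring
    · have ne_add (i : ℕ) : k ≠ l + 2 * i := by
        rcases i with _ | i
        · simpa using k_ne
        · exact fun hi => hk i (by lia)
      rw [h₁.eq_zero _ fun i hi => ne_add i (by lia), h₀.eq_zero k ne_add]
      simp

lemma hasMoments_gegenbauerMoment {κ : ℝ} (hκ : 1 / 2 ≤ κ) (l : ℕ) :
    HasMoments (gegenbauerMoment κ l) (gegenbauerConst κ l) (l + κ + 1) l := by
  have weight_moments := hasMoments_weightMoment (e := κ - 1 / 2) (by linarith)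
  induction l using Nat.twoStepInduction with
  | zero =>
    rw [gegenbauerMoment_zero, gegenbauerConst_zero]
    convert weight_moments using 1
    push_cast
    ring
  | one =>
    rw [gegenbauerMoment_one]
    convert (weight_moments.shift (by linarith)).const_mul (2 * κ) using 1
    · rw [gegenbauerConst_succ, gegenbauerConst_zero]
      push_cast
      ring
    · push_cast
      ring
  | more l ih₀ ih₁ =>
    have hc : (0 : ℝ) < l + κ + 1 := by positivity
    have const_succ : gegenbauerConst κ (l + 1) = gegenbauerConst κ l *
        (2 * (l + κ + 1) - l - 2) / (2 * (l + 1) * (l + κ + 1)) := by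
      rw [gegenbauerConst_succ]
      ring
    rw [const_succ, show ((l + 1 : ℕ) : ℝ) + κ + 1 = l + κ + 1 + 1 by push_cast; ring] at ih₁
    convert ih₀.of_recurrence hc ih₁ fun k => ?_ using 1
    · rw [gegenbauerConst_succ, const_succ]
      push_cast
      ring
    · push_cast
      ring
    · linear_combination gegenbauerMoment_recurrence hκ l k

end Moments

section SphereMoments

open Finset intervalIntegral

/-- The `k`-th moment `∫ X^k W` over `[a, b]`. -/
def moment (a b : ℝ) (X : ℝ → ℝ) (W : ℝ → ℂ) (k : ℕ) : ℂ := ∫ θ in a..b, (X θ : ℂ) ^ k * W θ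

lemma moment_gegenbauer (n l : ℕ) :
    (moment (-1) 1 id fun x => (gegenbauer l (((n : ℝ) - 2) / 2) x : ℂ) * (weight n x : ℂ)) =
      fun k => (gegenbauerMoment (((n : ℝ) - 2) / 2) l k : ℂ) := by
  funext k
  rw [moment, gegenbauerMoment, ← integral_ofReal]
  refine integral_congr fun x _ => ?_
  rw [weight, show ((n : ℝ) - 2) / 2 - 1 / 2 = ((n : ℝ) - 3) / 2 by ring]
  push_cast
  rw [id, mul_assoc]

lemma hasMoments_gegenbauer {n : ℕ} (hn : 3 ≤ n) (l : ℕ) :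
    HasMoments
      (moment (-1) 1 id fun x => (gegenbauer l (((n : ℝ) - 2) / 2) x : ℂ) * (weight n x : ℂ))
      (gegenbauerConst (((n : ℝ) - 2) / 2) l : ℂ) ((l : ℂ) + (n : ℂ) / 2) l := by
  have three_le : (3 : ℝ) ≤ n := mod_cast hn
  rw [moment_gegenbauer]
  convert (hasMoments_gegenbauerMoment (κ := ((n : ℝ) - 2) / 2) (by linarith) l).ofReal using 1
  push_cast
  ring

lemma integral_exp_int_mul (m : ℤ) :
    ∫ φ in (0 : ℝ)..(2 * Real.pi), Complex.exp (Complex.I * m * φ) =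
      if m = 0 then 2 * (Real.pi : ℂ) else 0 := by
  split_ifs with hm
  · simp [hm]
  · have period : Complex.I * (m : ℂ) * ((2 * Real.pi : ℝ) : ℂ) =
        m * (2 * Real.pi * Complex.I) := by
      push_cast
      ring
    rw [integral_exp_mul_complex (mul_ne_zero Complex.I_ne_zero (mod_cast hm)), period,
      Complex.exp_int_mul_two_pi_mul_I]
    simp

lemma cos_pow_mul_exp (l k : ℕ) (φ : ℝ) :
    (Real.cos φ : ℂ) ^ k * Complex.exp (-Complex.I * l * φ) =
      ∑ m ∈ range (k + 1), ((k.choose m : ℂ) / 2 ^ k) *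
        Complex.exp (Complex.I * (((k : ℤ) - 2 * m - l : ℤ) : ℂ) * φ) := by
  rw [Complex.ofReal_cos, Complex.cos, add_comm, div_pow, add_pow, sum_div, sum_mul]
  refine sum_congr rfl fun m hm => ?_
  rw [mem_range] at hm
  rw [← Complex.exp_nat_mul, ← Complex.exp_nat_mul, ← Complex.exp_add, div_mul_eq_mul_div,
    mul_right_comm, ← Complex.exp_add, Nat.cast_sub (by lia), div_mul_eq_mul_div, mul_comm]
  congr 2
  push_cast
  congr 1
  ring

lemma moment_circle (l k : ℕ) :
    moment 0 (2 * Real.pi) Real.cos (fun φ => Complex.exp (-Complex.I * l * φ)) k =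
      ∑ m ∈ range (k + 1), ((k.choose m : ℂ) / 2 ^ k) *
        if (k : ℤ) - 2 * m = l then 2 * (Real.pi : ℂ) else 0 := by
  simp only [moment, cos_pow_mul_exp]
  rw [integral_finsetSum fun m _ => Continuous.intervalIntegrable (by fun_prop) _ _]
  simp only [integral_const_mul, integral_exp_int_mul, sub_eq_zero]

lemma hasMoments_circle (l : ℕ) :
    HasMoments (moment 0 (2 * Real.pi) Real.cos fun φ => Complex.exp (-Complex.I * l * φ))
      (2 * (Real.pi : ℂ) / (2 ^ l * (l.factorial : ℂ))) ((l : ℂ) + ((2 : ℕ) : ℂ) / 2) l := by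
  refine ⟨fun i => ?_, fun k hk => ?_⟩
  · rw [moment_circle, sum_eq_single i, if_pos (by push_cast; ring), ← poch,
      show ((2 : ℕ) : ℂ) / 2 = 1 by norm_num]
    · have factorial_add := factorial_mul_poch l i
      have := factorial_cast_ne_zero l
      have := factorial_cast_ne_zero i
      have poch_ne : poch ((l : ℂ) + 1) i ≠ 0 := fun poch_eq =>
        factorial_cast_ne_zero (l + i) (by rw [← factorial_add, poch_eq, mul_zero])
      rw [Nat.cast_choose ℂ (by lia), show l + 2 * i - i = l + i by lia, ← factorial_add,
        pow_add, pow_mul, show (2 : ℂ) ^ 2 = 4 by norm_num]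
      field_simp
    · intro m _ hm
      rw [if_neg (by push_cast; lia), mul_zero]
    · exact fun hi => absurd (mem_range.mpr (by lia)) hi
  · rw [moment_circle]
    refine sum_eq_zero fun m _ => ?_
    rw [if_neg fun h => hk m (by lia), mul_zero]

lemma factorial_add_two_mul (s N : ℕ) {ν : ℕ} (hν : ν ≤ 1) :
    ((2 * s + ν + 2 * N).factorial : ℂ) = ((2 * s + ν).factorial : ℂ) * 4 ^ N *
      poch ((s : ℂ) + 1) N * poch ((s : ℂ) + ν + 1 / 2) N := by
  induction N with
  | zero => simp
  | succ N ih =>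
    rw [show 2 * s + ν + 2 * (N + 1) = 2 * s + ν + 2 * N + 1 + 1 by ring, Nat.factorial_succ,
      Nat.factorial_succ, Nat.cast_mul, Nat.cast_mul, ih, poch_succ, poch_succ]
    interval_cases ν <;> push_cast <;> ring

-- The two-point sphere `S⁰`, the case `n = 1`, `l = 0` of the parameter `l + n / 2`.
lemma hasMoments_point : HasMoments (fun k => if Even k then 1 else 0)
    1 (((0 : ℕ) : ℂ) + ((1 : ℕ) : ℂ) / 2) 0 := by
  refine ⟨fun i => ?_, fun k hk => if_neg ?_⟩
  · have duplication := factorial_add_two_mul 0 i (ν := 0) zero_le_one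
    simp only [Nat.cast_zero, mul_zero, zero_add, add_zero, Nat.factorial_zero, Nat.cast_one,
      one_mul, poch_one] at duplication ⊢
    rw [if_pos (even_two_mul i), ← poch, ← duplication, div_self (factorial_cast_ne_zero _)]
  · rintro ⟨i, hi⟩
    exact hk i (by lia)

end SphereMoments

section TermwiseIntegration

open Finset intervalIntegral

/-- The `n`-th coefficient of the Mehler expansion with the powers of its two variables replaced
by moments. -/
def momentCoeff (β : ℂ) (M M' : ℕ → ℂ) (n : ℕ) : ℂ :=
  (n.factorial : ℂ) / 2 ^ n * ∑ a ∈ range (n / 2 + 1), ∑ b ∈ range (n / 2 + 1),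
    (hermCoeff n a * 2 ^ (n - 2 * a) * M (n - 2 * a)) *
      (hermCoeff n b * 2 ^ (n - 2 * b) * M' (n - 2 * b)) * poch β (n - a - b)

lemma momentCoeff_symm (β : ℂ) (M M' : ℕ → ℂ) (n : ℕ) :
    momentCoeff β M M' n = momentCoeff β M' M n := by
  rw [momentCoeff, momentCoeff, sum_comm]
  congr 1
  refine sum_congr rfl fun a _ => sum_congr rfl fun b _ => ?_
  rw [Nat.sub_right_comm]
  ring

lemma mehlerCoeff_eq_momentCoeff (β x y : ℂ) (n : ℕ) :
    mehlerCoeff β x y n = momentCoeff β (fun k => x ^ k) (fun k => y ^ k) n := by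
  simp only [mehlerCoeff_eq, momentCoeff, mul_pow, mul_assoc]

lemma momentCoeff_even_part (β : ℂ) (M : ℕ → ℂ) {M' : ℕ → ℂ} {K c : ℂ}
    (h : HasMoments M' K c 0) (n : ℕ) :
    momentCoeff β M M' n = momentCoeff β (fun k => if Even k then M k else 0) M' n := by
  rw [momentCoeff, momentCoeff]
  congr 1
  refine sum_congr rfl fun a ha => sum_congr rfl fun b hb => ?_
  rw [mem_range] at ha hb
  by_cases even_sub : Even (n - 2 * a)
  · rw [if_pos even_sub]
  · rw [h.eq_zero (n - 2 * b) fun i hi => even_sub ⟨i + b - a, by lia⟩]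
    ring

lemma continuous_momentCoeff {Y : ℝ → ℝ} (hY : Continuous Y) (β : ℂ) (M : ℕ → ℂ) (n : ℕ) :
    Continuous fun φ => momentCoeff β M (fun k => (Y φ : ℂ) ^ k) n := by
  unfold momentCoeff
  fun_prop

lemma integral_momentCoeff {Y : ℝ → ℝ} {V : ℝ → ℂ} (hY : Continuous Y) (hV : Continuous V)
    (a b : ℝ) (β : ℂ) (M : ℕ → ℂ) (n : ℕ) (z : ℂ) :
    ∫ φ in a..b, momentCoeff β M (fun k => (Y φ : ℂ) ^ k) n * z * V φ =
      momentCoeff β M (moment a b Y V) n * z := by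
  have expand (φ : ℝ) : momentCoeff β M (fun k => (Y φ : ℂ) ^ k) n * z * V φ =
      ∑ i ∈ range (n / 2 + 1), ∑ j ∈ range (n / 2 + 1),
        ((n.factorial : ℂ) / 2 ^ n * z * ((hermCoeff n i * 2 ^ (n - 2 * i) * M (n - 2 * i)) *
          (hermCoeff n j * 2 ^ (n - 2 * j)) * poch β (n - i - j))) *
          ((Y φ : ℂ) ^ (n - 2 * j) * V φ) := by
    simp only [momentCoeff, mul_sum, sum_mul]
    refine sum_congr rfl fun i _ => sum_congr rfl fun j _ => ?_
    ring
  simp only [expand]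
  rw [integral_finsetSum fun i _ => Continuous.intervalIntegrable (by fun_prop) _ _]
  simp only [momentCoeff, mul_sum, sum_mul]
  refine sum_congr rfl fun i _ => ?_
  rw [integral_finsetSum fun j _ => Continuous.intervalIntegrable (by fun_prop) _ _]
  refine sum_congr rfl fun j _ => ?_
  rw [integral_const_mul, moment]
  ring

lemma hasSum_integral_of_bound {a b : ℝ} {F : ℕ → ℝ → ℂ} {f : ℝ → ℂ} {B : ℕ → ℝ}
    (hF : ∀ n, Continuous (F n)) (hB : Summable B)
    (hFB : ∀ n, ∀ x ∈ Set.uIcc a b, ‖F n x‖ ≤ B n)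
    (hf : ∀ x ∈ Set.uIcc a b, HasSum (fun n => F n x) (f x)) :
    HasSum (fun n => ∫ x in a..b, F n x) (∫ x in a..b, f x) :=
  hasSum_integral_of_dominated_convergence (fun n _ => B n)
    (fun n => (hF n).aestronglyMeasurable)
    (fun n => .of_forall fun x hx => hFB n x (Set.uIoc_subset_uIcc hx))
    (.of_forall fun _ _ => hB) intervalIntegrable_const
    (.of_forall fun x hx => hf x (Set.uIoc_subset_uIcc hx))

section

variable {c d : ℝ} {Y : ℝ → ℝ} {V : ℝ → ℂ}

lemma exists_bound_momentCoeff_pow_pow_mul (hV : Continuous V)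
    (hY₁ : ∀ φ ∈ Set.uIcc c d, Y φ ^ 2 ≤ 1) (β : ℂ) {t : ℝ} (ht : |t| < 1) :
    ∃ B : ℕ → ℝ, Summable B ∧ ∀ x : ℝ, x ^ 2 ≤ 1 → ∀ n, ∀ φ ∈ Set.uIcc c d,
      ‖momentCoeff β (fun k => (x : ℂ) ^ k) (fun k => (Y φ : ℂ) ^ k) n * (t : ℂ) ^ n * V φ‖
        ≤ B n := by
  obtain ⟨F, hF, coeff_bound⟩ := exists_bound_mehlerCoeff β ht
  obtain ⟨C, hC⟩ := isCompact_uIcc.exists_bound_of_continuousOn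
    (hV.continuousOn (s := Set.uIcc c d))
  refine ⟨fun n => F n * C, hF.mul_right C, fun x hx n φ hφ => ?_⟩
  rw [norm_mul, ← mehlerCoeff_eq_momentCoeff]
  have bound := coeff_bound x (Y φ) hx (hY₁ φ hφ) n
  exact mul_le_mul bound (hC φ hφ) (norm_nonneg _) ((norm_nonneg _).trans bound)

lemma exists_bound_momentCoeff_pow_moment (hY : Continuous Y) (hV : Continuous V)
    (hY₁ : ∀ φ ∈ Set.uIcc c d, Y φ ^ 2 ≤ 1) (β : ℂ) {t : ℝ} (ht : |t| < 1) :
    ∃ B : ℕ → ℝ, Summable B ∧ ∀ x : ℝ, x ^ 2 ≤ 1 → ∀ n,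
      ‖momentCoeff β (fun k => (x : ℂ) ^ k) (moment c d Y V) n * (t : ℂ) ^ n‖ ≤ B n := by
  obtain ⟨B, hB, bound⟩ := exists_bound_momentCoeff_pow_pow_mul hV hY₁ β ht
  refine ⟨fun n => B n * |d - c|, hB.mul_right _, fun x hx n => ?_⟩
  rw [← integral_momentCoeff hY hV]
  exact norm_integral_le_of_norm_le_const fun φ hφ => bound x hx n φ (Set.uIoc_subset_uIcc hφ)

lemma hasSum_integral_LamPow (hY : Continuous Y) (hV : Continuous V)
    (hY₁ : ∀ φ ∈ Set.uIcc c d, Y φ ^ 2 ≤ 1) (σ : ℂ) (α : ℝ) {x : ℝ} (hx : x ^ 2 ≤ 1) :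
    HasSum (fun n => momentCoeff (-σ / 2) (fun k => (x : ℂ) ^ k) (moment c d Y V) n *
      (Real.tanh α : ℂ) ^ n)
      ((Real.cosh α : ℂ) * ∫ φ in c..d, LamPow σ α x (Y φ) * V φ) := by
  obtain ⟨B, hB, bound⟩ :=
    exists_bound_momentCoeff_pow_pow_mul hV hY₁ (-σ / 2) (Real.abs_tanh_lt_one α)
  have sum_integral := hasSum_integral_of_bound
    (F := fun n φ => momentCoeff (-σ / 2) (fun k => (x : ℂ) ^ k) (fun k => (Y φ : ℂ) ^ k) n *
      (Real.tanh α : ℂ) ^ n * V φ)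
    (f := fun φ => (Real.cosh α : ℂ) * (LamPow σ α x (Y φ) * V φ))
    (fun n => ((continuous_momentCoeff hY _ _ n).mul continuous_const).mul hV) hB (bound x hx)
    (fun φ hφ => by
      simpa only [← mehlerCoeff_eq_momentCoeff, ← mul_assoc] using
        (hasSum_mehlerCoeff σ α hx (hY₁ φ hφ)).mul_right (V φ))
  simpa only [integral_momentCoeff hY hV, integral_const_mul] using sum_integral

lemma hasSum_integral_integral_LamPow {a b : ℝ} {X : ℝ → ℝ} {W : ℝ → ℂ}
    (hX : Continuous X) (hW : Continuous W) (hX₁ : ∀ θ ∈ Set.uIcc a b, X θ ^ 2 ≤ 1)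
    (hY : Continuous Y) (hV : Continuous V) (hY₁ : ∀ φ ∈ Set.uIcc c d, Y φ ^ 2 ≤ 1)
    (σ : ℂ) (α : ℝ) :
    HasSum (fun n => momentCoeff (-σ / 2) (moment a b X W) (moment c d Y V) n *
      (Real.tanh α : ℂ) ^ n)
      ((Real.cosh α : ℂ) * ∫ θ in a..b, ∫ φ in c..d, LamPow σ α (X θ) (Y φ) * (W θ * V φ)) := by
  obtain ⟨B, hB, bound⟩ :=
    exists_bound_momentCoeff_pow_moment hY hV hY₁ (-σ / 2) (Real.abs_tanh_lt_one α)
  obtain ⟨C, hC⟩ := isCompact_uIcc.exists_bound_of_continuousOn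
    (hW.continuousOn (s := Set.uIcc a b))
  have sum_integral := hasSum_integral_of_bound
    (F := fun n θ => momentCoeff (-σ / 2) (moment c d Y V) (fun k => (X θ : ℂ) ^ k) n *
      (Real.tanh α : ℂ) ^ n * W θ)
    (f := fun θ => (Real.cosh α : ℂ) * ((∫ φ in c..d, LamPow σ α (X θ) (Y φ) * V φ) * W θ))
    (fun n => ((continuous_momentCoeff hX _ _ n).mul continuous_const).mul hW)
    (hB.mul_right C) (fun n θ hθ => by
      rw [norm_mul, momentCoeff_symm]
      have bound_n := bound (X θ) (hX₁ θ hθ) n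
      exact mul_le_mul bound_n (hC θ hθ) (norm_nonneg _) ((norm_nonneg _).trans bound_n))
    (fun θ hθ => by
      simp only [momentCoeff_symm _ (moment c d Y V), ← mul_assoc]
      exact (hasSum_integral_LamPow hY hV hY₁ σ α (hX₁ θ hθ)).mul_right (W θ))
  simp only [integral_momentCoeff hX hW, integral_const_mul] at sum_integral
  simp only [momentCoeff_symm _ (moment c d Y V), ← integral_mul_const] at sum_integral
  simpa only [mul_assoc, mul_comm (V _)] using sum_integral

end

end TermwiseIntegration

section MomentCoefficients

open Finset

lemma sum_hermCoeff_mul_moment {M : ℕ → ℂ} {K c : ℂ} {l : ℕ} (hM : HasMoments M K c l) (N : ℕ)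
    (g : ℕ → ℂ) :
    ∑ a ∈ range ((l + 2 * N) / 2 + 1), hermCoeff (l + 2 * N) a * 2 ^ (l + 2 * N - 2 * a) *
        M (l + 2 * N - 2 * a) * g a =
      2 ^ l * K * ∑ ik ∈ antidiagonal N, (-1) ^ ik.2 /
        ((ik.1.factorial : ℂ) * (ik.2.factorial : ℂ) * poch c ik.1) * g ik.2 := by
  have truncate : ∑ a ∈ range (N + 1), hermCoeff (l + 2 * N) a * 2 ^ (l + 2 * N - 2 * a) *
        M (l + 2 * N - 2 * a) * g a =
      ∑ a ∈ range ((l + 2 * N) / 2 + 1), hermCoeff (l + 2 * N) a * 2 ^ (l + 2 * N - 2 * a) *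
        M (l + 2 * N - 2 * a) * g a := by
    refine sum_subset (range_subset_range.mpr (by lia)) fun a ha ha' => ?_
    rw [mem_range] at ha ha'
    rw [hM.eq_zero _ fun i hi => ha' (by lia), mul_zero, zero_mul]
  rw [← truncate, ← Nat.sum_antidiagonal_eq_sum_range_succ (fun a _ => hermCoeff (l + 2 * N) a *
      2 ^ (l + 2 * N - 2 * a) * M (l + 2 * N - 2 * a) * g a) N, ← Nat.sum_antidiagonal_swap,
    mul_sum]
  refine sum_congr rfl fun ik hik => ?_
  rw [HasAntidiagonal.mem_antidiagonal] at hik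
  have degree_eq : l + 2 * N - 2 * ik.2 = l + 2 * ik.1 := by lia
  have four_pow : (4 : ℂ) ^ ik.1 = (2 ^ 2) ^ ik.1 := by norm_num
  simp only [Prod.fst_swap, hermCoeff, degree_eq, hM.apply_eq_poch, pow_add, pow_mul,
    four_pow]
  have := factorial_cast_ne_zero (l + 2 * ik.1)
  by_cases hc : poch c ik.1 = 0
  · simp [hc]
  · field_simp

lemma momentCoeff_eq_zero {M M' : ℕ → ℂ} {K c : ℂ} {l : ℕ} (hM : HasMoments M K c l) (β : ℂ)
    {n : ℕ} (hn : ∀ N, n ≠ l + 2 * N) : momentCoeff β M M' n = 0 := by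
  rw [momentCoeff, sum_eq_zero, mul_zero]
  intro a ha
  rw [mem_range] at ha
  refine sum_eq_zero fun b _ => ?_
  rw [hM.eq_zero _ fun i hi => hn (i + a) (by lia)]
  simp

section

variable {M M' : ℕ → ℂ} {K K' c d : ℂ} {ν r s : ℕ}

lemma momentCoeff_eq_sum_sum (hrs : r ≤ s) (hM : HasMoments M K c (ν + 2 * s))
    (hM' : HasMoments M' K' d (ν + 2 * r)) (β : ℂ) (N : ℕ) :
    momentCoeff β M M' (ν + 2 * s + 2 * N) =
      ((ν + 2 * s + 2 * N).factorial : ℂ) / 4 ^ N * (K * (2 ^ (ν + 2 * r) * K')) *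
      ∑ ik ∈ antidiagonal N, ∑ jl ∈ antidiagonal (N + (s - r)), (-1) ^ (ik.2 + jl.2) *
        poch β (s + r + ν + (ik.1 + jl.1)) /
        ((ik.1.factorial : ℂ) * (ik.2.factorial : ℂ) * poch c ik.1 *
          ((jl.1.factorial : ℂ) * (jl.2.factorial : ℂ) * poch d jl.1)) := by
  have degree_eq : ν + 2 * s + 2 * N = ν + 2 * r + 2 * (N + (s - r)) := by lia
  have inner_sum (a : ℕ) : ∑ b ∈ range ((ν + 2 * s + 2 * N) / 2 + 1),
      (hermCoeff (ν + 2 * s + 2 * N) a * 2 ^ (ν + 2 * s + 2 * N - 2 * a) *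
        M (ν + 2 * s + 2 * N - 2 * a)) *
      (hermCoeff (ν + 2 * s + 2 * N) b * 2 ^ (ν + 2 * s + 2 * N - 2 * b) *
        M' (ν + 2 * s + 2 * N - 2 * b)) * poch β (ν + 2 * s + 2 * N - a - b) =
      hermCoeff (ν + 2 * s + 2 * N) a * 2 ^ (ν + 2 * s + 2 * N - 2 * a) *
        M (ν + 2 * s + 2 * N - 2 * a) * (2 ^ (ν + 2 * r) * K' *
        ∑ jl ∈ antidiagonal (N + (s - r)), (-1) ^ jl.2 /
        ((jl.1.factorial : ℂ) * (jl.2.factorial : ℂ) * poch d jl.1) *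
          poch β (ν + 2 * s + 2 * N - a - jl.2)) := by
    rw [← sum_hermCoeff_mul_moment hM' (N + (s - r))
      (fun b => poch β (ν + 2 * s + 2 * N - a - b)), mul_sum, ← degree_eq]
    refine sum_congr rfl fun b _ => ?_
    ring
  rw [momentCoeff, sum_congr rfl fun a _ => inner_sum a, sum_hermCoeff_mul_moment hM N
    (fun a => 2 ^ (ν + 2 * r) * K' * ∑ jl ∈ antidiagonal (N + (s - r)), (-1) ^ jl.2 /
        ((jl.1.factorial : ℂ) * (jl.2.factorial : ℂ) * poch d jl.1) *
          poch β (ν + 2 * s + 2 * N - a - jl.2))]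
  simp only [mul_sum]
  refine sum_congr rfl fun ik hik => sum_congr rfl fun jl hjl => ?_
  rw [HasAntidiagonal.mem_antidiagonal] at hik hjl
  have index_eq : ν + 2 * s + 2 * N - ik.2 - jl.2 = s + r + ν + (ik.1 + jl.1) := by lia
  have scale : ((ν + 2 * s + 2 * N).factorial : ℂ) / 2 ^ (ν + 2 * s + 2 * N) * 2 ^ (ν + 2 * s) =
      ((ν + 2 * s + 2 * N).factorial : ℂ) / 4 ^ N := by
    rw [pow_add _ _ (2 * N), pow_mul _ 2 N, div_mul_eq_mul_div, mul_comm (2 ^ (ν + 2 * s)),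
      mul_div_mul_right _ _ (pow_ne_zero _ two_ne_zero)]
    norm_num
  rw [index_eq, ← scale]
  ring

lemma momentCoeff_eq (hrs : r ≤ s) (hM : HasMoments M K c (ν + 2 * s))
    (hM' : HasMoments M' K' d (ν + 2 * r)) (hν : ν ≤ 1) {N : ℕ} (hc : poch c N ≠ 0)
    (hd : poch d (N + (s - r)) ≠ 0) {β a : ℂ} (ha : β + (s + r + ν : ℕ) = a) :
    momentCoeff β M M' (ν + 2 * s + 2 * N) =
      ((2 * s + ν).factorial : ℂ) * poch (1 - (d - a) - (s - r : ℕ)) (s - r) /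
        (((s - r).factorial : ℂ) * poch d (s - r)) *
      poch β (s + r + ν) * (K * (2 ^ (ν + 2 * r) * K')) *
      ∑ mn ∈ antidiagonal N,
        poch ((s : ℂ) + 1) N * poch ((s : ℂ) + ν + 1 / 2) N /
          (poch c N * poch (d + (s - r : ℕ)) N) *
        (poch a mn.1 / (mn.1.factorial : ℂ)) *
        (poch (d - a + (s - r : ℕ)) mn.2 * poch (c - a) mn.2 /
          (poch (1 + (s - r : ℕ)) mn.2 * (mn.2.factorial : ℂ))) := by
  have four_pow_ne_zero : (4 : ℂ) ^ N ≠ 0 := pow_ne_zero _ (by norm_num)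
  have factorial_div : ((ν + 2 * s + 2 * N).factorial : ℂ) / 4 ^ N =
      ((2 * s + ν).factorial : ℂ) * poch ((s : ℂ) + 1) N * poch ((s : ℂ) + ν + 1 / 2) N := by
    rw [add_comm ν (2 * s), factorial_add_two_mul s N hν]
    field_simp
  have factor_out : ∑ ik ∈ antidiagonal N, ∑ jl ∈ antidiagonal (N + (s - r)), (-1) ^ (ik.2 + jl.2) *
        poch β (s + r + ν + (ik.1 + jl.1)) /
        ((ik.1.factorial : ℂ) * (ik.2.factorial : ℂ) * poch c ik.1 *
          ((jl.1.factorial : ℂ) * (jl.2.factorial : ℂ) * poch d jl.1)) =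
      poch β (s + r + ν) *
      ∑ ik ∈ antidiagonal N, ∑ jl ∈ antidiagonal (N + (s - r)), (-1) ^ (ik.2 + jl.2) *
        poch a (ik.1 + jl.1) /
        ((ik.1.factorial : ℂ) * (ik.2.factorial : ℂ) * poch c ik.1 *
          ((jl.1.factorial : ℂ) * (jl.2.factorial : ℂ) * poch d jl.1)) := by
    simp only [mul_sum]
    refine sum_congr rfl fun ik _ => sum_congr rfl fun jl _ => ?_
    rw [poch_add β, ha]
    ring
  rw [momentCoeff_eq_sum_sum hrs hM hM', factor_out, sum_sum_antidiagonal_poch_div a hc hd,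
    factorial_div, poch_one_sub_sub, add_comm N, poch_add d]
  simp only [mul_sum]
  refine sum_congr rfl fun mn _ => ?_
  ring

end

end MomentCoefficients

section HornSeries

open Finset

lemma factorial_le_norm_poch_one_add (k n : ℕ) :
    (n.factorial : ℝ) ≤ ‖poch (1 + (k : ℂ)) n‖ := by
  have norm_eq := congrArg norm (factorial_mul_poch k n)
  rw [norm_mul, Complex.norm_natCast, Complex.norm_natCast, add_comm (k : ℂ)] at norm_eq
  have factorial_le : (k.factorial : ℝ) * n.factorial ≤ ((k + n).factorial : ℝ) := mod_cast
    Nat.le_of_dvd (Nat.factorial_pos _) (Nat.factorial_mul_factorial_dvd_factorial_add k n)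
  rw [← norm_eq] at factorial_le
  exact le_of_mul_le_mul_left factorial_le (mod_cast k.factorial_pos)

lemma summable_poch_mul_poch (a b : ℂ) (k : ℕ) {T : ℝ} (hT₀ : 0 ≤ T) (hT : T < 1) :
    Summable fun n : ℕ => ‖poch a n * poch b n / (poch (1 + k) n * (n.factorial : ℂ))‖ * T ^ n := by
  have sqrt_lt_one : √T < 1 := by rwa [Real.sqrt_lt' one_pos, one_pow]
  have diagonal := ((summable_norm_poch_div a (Real.sqrt_nonneg T) sqrt_lt_one).mul_of_nonneg
    (summable_norm_poch_div b (Real.sqrt_nonneg T) sqrt_lt_one) (fun _ => by positivity)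
    (fun _ => by positivity)).comp_injective (i := fun n : ℕ => (n, n))
    (fun _ _ h => congrArg Prod.fst h)
  refine diagonal.of_nonneg_of_le (fun n => by positivity) fun n => ?_
  have pow_eq : T ^ n = √T ^ n * √T ^ n := by rw [← mul_pow, Real.mul_self_sqrt hT₀]
  simp only [Function.comp, norm_div, norm_mul, Complex.norm_natCast, pow_eq]
  calc _ ≤ ‖poch a n‖ * ‖poch b n‖ / ((n.factorial : ℝ) * n.factorial) * (√T ^ n * √T ^ n) := by
        gcongr
        exact factorial_le_norm_poch_one_add k n
    _ = _ := by ring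

lemma norm_poch_le_norm_poch {x c : ℝ} (hx : 0 ≤ x) (hxc : x ≤ c) (n : ℕ) :
    ‖poch (x : ℂ) n‖ ≤ ‖poch (c : ℂ) n‖ := by
  induction n with
  | zero => simp
  | succ n ih =>
    rw [poch_succ, poch_succ, norm_mul, norm_mul]
    gcongr
    rw [← Complex.ofReal_natCast, ← Complex.ofReal_add, ← Complex.ofReal_add, Complex.norm_real,
      Complex.norm_real, Real.norm_of_nonneg (by positivity),
      Real.norm_of_nonneg (by linarith [Nat.cast_nonneg (α := ℝ) n])]
    linarith

section

variable {p q r s : ℕ}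

lemma hornTerm_eq (p q ν : ℕ) (σ : ℂ) (hrs : r ≤ s) (α : ℝ) (n : Fin 2 → ℕ) :
    hornTerm u5 (assocNum p q ν σ r s) v3 (assocDen p q ν r s) (tanhSq α) n =
      poch ((s : ℂ) + 1) (n 0 + n 1) * poch ((s : ℂ) + ν + 1 / 2) (n 0 + n 1) /
        (poch (2 * (s : ℂ) + ν + (p : ℂ) / 2) (n 0 + n 1) *
          poch ((s : ℂ) + r + ν + (q : ℂ) / 2) (n 0 + n 1)) *
      (poch ((s : ℂ) + r + ν - σ / 2) (n 0) / ((n 0).factorial : ℂ)) *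
      (poch (((q : ℂ) + σ) / 2) (n 1) * poch ((s : ℂ) - r + ((p : ℂ) + σ) / 2) (n 1) /
        (poch (1 + (s - r : ℕ)) (n 1) * ((n 1).factorial : ℂ))) *
      ((Real.tanh α : ℂ) ^ 2) ^ (n 0 + n 1) := by
  have lower_param : 1 + ((s - r : ℕ) : ℂ) = 1 + (s : ℂ) - r := by
    rw [Nat.cast_sub hrs, add_sub_assoc]
  rw [lower_param]
  simp only [hornTerm, u5, v3, assocNum, assocDen, tanhSq, Fin.prod_univ_five,
    Fin.prod_univ_three, Fin.prod_univ_two, Fin.sum_univ_two, Matrix.cons_val, one_mul, zero_mul,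
    add_zero, zero_add, Complex.ofReal_pow]
  ring

lemma norm_poch_ratio_le_one (hp : 2 ≤ p) (hq : 1 ≤ q) (ν r s N : ℕ) :
    ‖poch ((s : ℂ) + 1) N * poch ((s : ℂ) + ν + 1 / 2) N /
      (poch (2 * (s : ℂ) + ν + (p : ℂ) / 2) N * poch ((s : ℂ) + r + ν + (q : ℂ) / 2) N)‖ ≤ 1 := by
  have two_le : (2 : ℝ) ≤ p := mod_cast hp
  have one_le : (1 : ℝ) ≤ q := mod_cast hq
  have := Nat.cast_nonneg (α := ℝ) s
  have := Nat.cast_nonneg (α := ℝ) r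
  have := Nat.cast_nonneg (α := ℝ) ν
  have left_le := norm_poch_le_norm_poch (x := (s : ℝ) + 1) (c := 2 * (s : ℝ) + ν + (p : ℝ) / 2)
    (by positivity) (by linarith) N
  have right_le := norm_poch_le_norm_poch (x := (s : ℝ) + ν + 1 / 2)
    (c := (s : ℝ) + r + ν + (q : ℝ) / 2) (by positivity) (by linarith) N
  push_cast at left_le right_le
  rw [norm_div, norm_mul, norm_mul]
  exact div_le_one_of_le₀ (by gcongr) (by positivity)

lemma summable_hornTerm (hp : 2 ≤ p) (hq : 1 ≤ q) (ν : ℕ) (σ : ℂ) (hrs : r ≤ s) (α : ℝ) :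
    Summable (hornTerm u5 (assocNum p q ν σ r s) v3 (assocDen p q ν r s) (tanhSq α)) := by
  have tanh_sq_lt_one : Real.tanh α ^ 2 < 1 :=
    (sq_lt_one_iff_abs_lt_one _).mpr (Real.abs_tanh_lt_one α)
  have majorant := (summable_norm_poch_div ((s : ℂ) + r + ν - σ / 2) (sq_nonneg (Real.tanh α))
    tanh_sq_lt_one).mul_of_nonneg (summable_poch_mul_poch (((q : ℂ) + σ) / 2)
      ((s : ℂ) - r + ((p : ℂ) + σ) / 2) (s - r) (sq_nonneg (Real.tanh α)) tanh_sq_lt_one)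
    (fun _ => by positivity) (fun _ => by positivity)
  refine .of_norm ((majorant.comp_injective (finTwoArrowEquiv ℕ).injective).of_nonneg_of_le
    (fun _ => norm_nonneg _) fun n => ?_)
  rw [hornTerm_eq p q ν σ hrs, norm_mul, norm_mul, norm_mul, norm_pow, norm_pow, Complex.norm_real,
    Real.norm_eq_abs, sq_abs]
  rw [Function.comp_apply, show finTwoArrowEquiv ℕ n = (n 0, n 1) from rfl]
  calc _ ≤ 1 * ‖poch ((s : ℂ) + r + ν - σ / 2) (n 0) / ((n 0).factorial : ℂ)‖ *
        ‖poch (((q : ℂ) + σ) / 2) (n 1) * poch ((s : ℂ) - r + ((p : ℂ) + σ) / 2) (n 1) /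
        (poch (1 + (s - r : ℕ)) (n 1) * ((n 1).factorial : ℂ))‖ *
        (Real.tanh α ^ 2) ^ (n 0 + n 1) := by
        gcongr
        exact norm_poch_ratio_le_one hp hq ν r s _
    _ = _ := by ring

lemma hasSum_hornSeries (hp : 2 ≤ p) (hq : 1 ≤ q) (ν : ℕ) (σ : ℂ) (hrs : r ≤ s) (α : ℝ) :
    HasSum (fun N => ∑ mn ∈ antidiagonal N,
      hornTerm u5 (assocNum p q ν σ r s) v3 (assocDen p q ν r s) (tanhSq α) ![mn.1, mn.2])
      (hornSeries u5 (assocNum p q ν σ r s) v3 (assocDen p q ν r s) (tanhSq α)) := by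
  have sum_horn := (summable_hornTerm hp hq ν σ hrs α).hasSum
  rw [← (finTwoArrowEquiv ℕ).symm.hasSum_iff,
    ← (HasAntidiagonal.sigmaAntidiagonalEquivProd (A := ℕ)).hasSum_iff] at sum_horn
  rw [hornSeries]
  convert sum_horn.sigma fun N => hasSum_fintype _ using 2 with N
  rw [← sum_coe_sort (antidiagonal N)]
  rfl

lemma momentCoeff_mul_tanh_pow {ν : ℕ} (hp : 2 ≤ p) (hq : 1 ≤ q) (hν : ν ≤ 1) (hrs : r ≤ s)
    {M M' : ℕ → ℂ} {K K' : ℂ}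
    (hM : HasMoments M K (((ν + 2 * s : ℕ) : ℂ) + (p : ℂ) / 2) (ν + 2 * s))
    (hM' : HasMoments M' K' (((ν + 2 * r : ℕ) : ℂ) + (q : ℂ) / 2) (ν + 2 * r))
    (σ : ℂ) (α : ℝ) (N : ℕ) :
    momentCoeff (-σ / 2) M M' (ν + 2 * s + 2 * N) * (Real.tanh α : ℂ) ^ (ν + 2 * s + 2 * N) =
      ((2 * s + ν).factorial : ℂ) * poch ((2 - σ - q) / 2) (s - r) /
      (((s - r).factorial : ℂ) * poch (2 * (r : ℂ) + ν + (q : ℂ) / 2) (s - r)) *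
      poch (-σ / 2) (s + r + ν) * (K * (2 ^ (ν + 2 * r) * K')) *
      (Real.tanh α : ℂ) ^ (2 * s + ν) * ∑ mn ∈ antidiagonal N,
      hornTerm u5 (assocNum p q ν σ r s) v3 (assocDen p q ν r s) (tanhSq α) ![mn.1, mn.2] := by
  have cast_diff : ((s - r : ℕ) : ℂ) = s - r := Nat.cast_sub hrs
  have param_ne_zero {l n : ℕ} (hn : 1 ≤ n) (k : ℕ) : poch ((l : ℂ) + (n : ℂ) / 2) k ≠ 0 := by
    have : (0 : ℝ) < n := mod_cast hn
    simpa using poch_ofReal_ne_zero (a := (l : ℝ) + (n : ℝ) / 2) (by positivity) k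
  rw [momentCoeff_eq hrs hM hM' hν (param_ne_zero (by lia) _) (param_ne_zero hq _) rfl,
    show ν + 2 * s + 2 * N = 2 * s + ν + 2 * N by ring, pow_add _ (2 * s + ν), pow_mul _ 2 N]
  simp only [mul_sum, sum_mul]
  refine sum_congr rfl fun mn hmn => ?_
  rw [HasAntidiagonal.mem_antidiagonal] at hmn
  rw [hornTerm_eq p q ν σ hrs]
  simp only [Matrix.cons_val_zero, Matrix.cons_val_one, hmn, cast_diff]
  push_cast
  ring_nf

lemma eq_hornSeries_of_hasSum {ν : ℕ} (hp : 2 ≤ p) (hq : 1 ≤ q) (hν : ν ≤ 1) (hrs : r ≤ s)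
    {M M' : ℕ → ℂ} {K K' T : ℂ}
    (hM : HasMoments M K (((ν + 2 * s : ℕ) : ℂ) + (p : ℂ) / 2) (ν + 2 * s))
    (hM' : HasMoments M' K' (((ν + 2 * r : ℕ) : ℂ) + (q : ℂ) / 2) (ν + 2 * r))
    (σ : ℂ) (α : ℝ)
    (hT : HasSum (fun n => momentCoeff (-σ / 2) M M' n * (Real.tanh α : ℂ) ^ n) T) :
    T = ((2 * s + ν).factorial : ℂ) * poch ((2 - σ - q) / 2) (s - r) /
      (((s - r).factorial : ℂ) * poch (2 * (r : ℂ) + ν + (q : ℂ) / 2) (s - r)) *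
      poch (-σ / 2) (s + r + ν) * (K * (2 ^ (ν + 2 * r) * K')) *
      (Real.tanh α : ℂ) ^ (2 * s + ν) *
      hornSeries u5 (assocNum p q ν σ r s) v3 (assocDen p q ν r s) (tanhSq α) := by
  have index_injective : Function.Injective fun N => ν + 2 * s + 2 * N := fun a b h => by
    simpa using h
  rw [← index_injective.hasSum_iff fun n hn => by
    rw [momentCoeff_eq_zero hM _ fun N hN => hn ⟨N, hN.symm⟩, zero_mul]] at hT
  simp only [Function.comp_def, momentCoeff_mul_tanh_pow hp hq hν hrs hM hM'] at hT
  exact hT.unique ((hasSum_hornSeries hp hq ν σ hrs α).mul_left _)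

end

end HornSeries

section Normalization
open Finset

/-- The normalizing factor of the degree `l` basis function on the unit sphere of `ℝ^n`: the
multipliers `aOne` and `aTwo` are products of two of these. -/
def sphereNorm (n l : ℕ) : ℝ :=
  if n = 2 then 1 / (2 * Real.pi) else
    Real.Gamma (((n : ℝ) - 2) / 2) *
      √((2 : ℝ) ^ ((n : ℝ) - 4) * Real.Gamma ((n : ℝ) / 2) * (l.factorial : ℝ) *
          (2 * (l : ℝ) + n - 2) /
        (Real.pi ^ ((3 : ℝ) / 2) * Real.Gamma (((n : ℝ) - 1) / 2) * Real.Gamma ((l : ℝ) + n - 2)))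

lemma pi_rpow_three_half : Real.pi ^ ((3 : ℝ) / 2) = √Real.pi ^ 3 := by
  rw [Real.sqrt_eq_rpow, ← Real.rpow_mul_natCast Real.pi_pos.le]; norm_num

lemma aTwo_eq {p q : ℕ} (hp : 3 ≤ p) (hq : 3 ≤ q) (lam mu : ℕ) :
    aTwo p q lam mu = sphereNorm p mu * sphereNorm q lam := by
  have : (3 : ℝ) ≤ p := mod_cast hp
  have : (3 : ℝ) ≤ q := mod_cast hq
  have : (0 : ℝ) ≤ lam := Nat.cast_nonneg _
  have : (0 : ℝ) ≤ mu := Nat.cast_nonneg _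
  have := Real.Gamma_pos_of_pos (s := (p : ℝ) / 2) (by linarith)
  have := Real.Gamma_pos_of_pos (s := (q : ℝ) / 2) (by linarith)
  have := Real.Gamma_pos_of_pos (s := ((p : ℝ) - 1) / 2) (by linarith)
  have := Real.Gamma_pos_of_pos (s := ((q : ℝ) - 1) / 2) (by linarith)
  have := Real.Gamma_pos_of_pos (s := (lam : ℝ) + q - 2) (by linarith)
  have := Real.Gamma_pos_of_pos (s := (mu : ℝ) + p - 2) (by linarith)
  have : 0 < 2 * (mu : ℝ) + p - 2 := by linarith
  have : 0 < 2 * (lam : ℝ) + q - 2 := by linarith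
  have two_rpow_split : (2 : ℝ) ^ ((p : ℝ) + q - 8) = 2 ^ ((p : ℝ) - 4) * 2 ^ ((q : ℝ) - 4) := by
    rw [← Real.rpow_add (by norm_num)]; congr 1; ring
  have pi_cube : Real.pi ^ 3 = √Real.pi ^ 3 * √Real.pi ^ 3 := by
    rw [← mul_pow, Real.mul_self_sqrt Real.pi_pos.le]
  rw [aTwo, sphereNorm, sphereNorm, if_neg (by lia), if_neg (by lia), mul_assoc,
    ← Real.sqrt_mul (by positivity), mul_mul_mul_comm, ← Real.sqrt_mul (by positivity),
    pi_rpow_three_half, two_rpow_split, pi_cube]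
  congr 2
  field_simp

lemma aOne_eq {p : ℕ} (hp : 3 ≤ p) (mu : ℕ) :
    aOne p mu = sphereNorm p mu * (1 / (2 * Real.pi)) := by
  have two_rpow_split : (2 : ℝ) ^ ((p : ℝ) - 6) = 2 ^ ((p : ℝ) - 4) / 4 := by
    rw [show (p : ℝ) - 6 = (p : ℝ) - 4 - 2 by ring, Real.rpow_sub (by norm_num)]; norm_num
  have pi_rpow_split : Real.pi ^ ((7 : ℝ) / 2) = Real.pi ^ ((3 : ℝ) / 2) * Real.pi ^ 2 := by
    rw [← Real.rpow_natCast, ← Real.rpow_add Real.pi_pos]; norm_num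
  have inv_two_pi : 1 / (2 * Real.pi) = √((1 / (2 * Real.pi)) ^ 2) :=
    (Real.sqrt_sq (by positivity)).symm
  rw [aOne, sphereNorm, if_neg (by lia), inv_two_pi, mul_assoc (Real.Gamma (((p : ℝ) - 2) / 2)),
    ← Real.sqrt_mul' _ (by positivity), two_rpow_split, pi_rpow_split]
  congr 2
  field_simp
  norm_num

lemma Gamma_add_natCast {a : ℝ} (ha : 0 < a) (l : ℕ) :
    Real.Gamma (a + l) = (ascPochhammer ℝ l).eval a * Real.Gamma a := by
  induction l with
  | zero => simp
  | succ l ih =>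
    rw [Nat.cast_succ, ← add_assoc, Real.Gamma_add_one (by positivity), ih,
      ascPochhammer_succ_eval]
    ring

lemma Gamma_natCast_sub_two (n : ℕ) :
    Real.Gamma ((n : ℝ) - 2) =
      Real.Gamma (((n : ℝ) - 2) / 2) * Real.Gamma (((n : ℝ) - 1) / 2) * 2 ^ n /
        (8 * √Real.pi) := by
  have duplication := Real.Gamma_mul_Gamma_add_half (((n : ℝ) - 2) / 2)
  rw [show ((n : ℝ) - 2) / 2 + 1 / 2 = ((n : ℝ) - 1) / 2 by ring,
    show 2 * (((n : ℝ) - 2) / 2) = (n : ℝ) - 2 by ring,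
    show 1 - ((n : ℝ) - 2) = (3 : ℕ) - (n : ℕ) by push_cast; ring, Real.rpow_sub (by norm_num),
    Real.rpow_natCast, Real.rpow_natCast] at duplication
  rw [duplication]
  field_simp
  ring

lemma gegenbauerConst_eq {n : ℕ} (hn : 3 ≤ n) (l : ℕ) :
    gegenbauerConst (((n : ℝ) - 2) / 2) l = √Real.pi * Real.Gamma (((n : ℝ) - 1) / 2) *
      Real.Gamma ((l : ℝ) + n - 2) / (Real.Gamma ((n : ℝ) - 2) * 2 ^ l * (l.factorial : ℝ) *
        Real.Gamma ((l : ℝ) + (n : ℝ) / 2)) := by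
  obtain ⟨m, rfl⟩ := Nat.exists_eq_add_of_le hn
  push_cast
  rw [gegenbauerConst, show (3 + (m : ℝ) - 2) / 2 - 1 / 2 = (m : ℝ) / 2 by ring,
    weightMoment_zero m, show (l : ℝ) + (3 + m) - 2 = (1 + (m : ℝ)) + l by ring,
    Gamma_add_natCast (a := 1 + (m : ℝ)) (by positivity),
    show (l : ℝ) + (3 + (m : ℝ)) / 2 = ((m : ℝ) / 2 + 3 / 2) + l by ring,
    Gamma_add_natCast (a := (m : ℝ) / 2 + 3 / 2) (by positivity),
    show 2 * ((3 + (m : ℝ) - 2) / 2) = 1 + m by ring,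
    show (3 + (m : ℝ) - 2) / 2 + 1 = (m : ℝ) / 2 + 3 / 2 by ring,
    show 3 + (m : ℝ) - 2 = 1 + m by ring, show (3 + (m : ℝ) - 1) / 2 = (m : ℝ) / 2 + 1 by ring]
  have := (Real.Gamma_pos_of_pos (s := 1 + (m : ℝ)) (by positivity)).ne'
  generalize (ascPochhammer ℝ l).eval ((m : ℝ) / 2 + 3 / 2) = poch_val
  generalize Real.Gamma ((m : ℝ) / 2 + 3 / 2) = Gamma_val
  field_simp

/-- The leading constant, in the sense of `HasMoments`, of the moments of the normalized degree `l`
basis function on the unit sphere of `ℝ^n`. -/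
def sphereConst (n l : ℕ) : ℝ :=
  sphereNorm n l * if n = 2 then 2 * Real.pi / (2 ^ l * (l.factorial : ℝ))
    else gegenbauerConst (((n : ℝ) - 2) / 2) l

lemma sphereConst_two (l : ℕ) : sphereConst 2 l = 1 / (2 ^ l * l.factorial) := by
  rw [sphereConst, sphereNorm, if_pos rfl, if_pos rfl]
  field_simp

lemma sphereConst_of_three_le {n : ℕ} (hn : 3 ≤ n) (l : ℕ) :
    sphereConst n l = sphereNorm n l * (√Real.pi * Real.Gamma (((n : ℝ) - 1) / 2) *
      Real.Gamma ((l : ℝ) + n - 2) / (Real.Gamma ((n : ℝ) - 2) * 2 ^ l * (l.factorial : ℝ) *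
        Real.Gamma ((l : ℝ) + (n : ℝ) / 2))) := by
  rw [sphereConst, if_neg (by lia), gegenbauerConst_eq hn]

lemma sphereNorm_nonneg {n : ℕ} (hn : 2 ≤ n) (l : ℕ) : 0 ≤ sphereNorm n l := by
  have : (2 : ℝ) ≤ n := mod_cast hn
  rw [sphereNorm]
  split_ifs
  · positivity
  · exact mul_nonneg (Real.Gamma_nonneg_of_nonneg (by linarith)) (Real.sqrt_nonneg _)

lemma sphereNorm_sq {n : ℕ} (hn : 3 ≤ n) (l : ℕ) :
    sphereNorm n l ^ 2 = Real.Gamma (((n : ℝ) - 2) / 2) ^ 2 *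
      (2 ^ n / 16 * Real.Gamma ((n : ℝ) / 2) * (l.factorial : ℝ) * (2 * (l : ℝ) + n - 2) /
        (√Real.pi ^ 3 * Real.Gamma (((n : ℝ) - 1) / 2) * Real.Gamma ((l : ℝ) + n - 2))) := by
  have : (3 : ℝ) ≤ n := mod_cast hn
  have : (0 : ℝ) ≤ l := Nat.cast_nonneg _
  have := Real.Gamma_pos_of_pos (s := (n : ℝ) / 2) (by linarith)
  have := Real.Gamma_pos_of_pos (s := ((n : ℝ) - 1) / 2) (by linarith)
  have := Real.Gamma_pos_of_pos (s := (l : ℝ) + n - 2) (by linarith)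
  have : 0 < 2 * (l : ℝ) + n - 2 := by linarith
  have two_rpow : (2 : ℝ) ^ ((n : ℝ) - 4) = 2 ^ n / 16 := by
    rw [Real.rpow_sub (by norm_num), Real.rpow_natCast]; norm_num
  rw [sphereNorm, if_neg (by lia), mul_pow, pi_rpow_three_half, two_rpow,
    Real.sq_sqrt (by positivity)]

lemma sphereNorm_zero {n : ℕ} (hn : 3 ≤ n) : sphereNorm n 0 =
    Real.Gamma ((n : ℝ) / 2) / (√Real.pi * Real.Gamma (((n : ℝ) - 1) / 2)) := by
  have : (3 : ℝ) ≤ n := mod_cast hn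
  have : 0 < (n : ℝ) - 2 := by linarith
  have := Real.Gamma_pos_of_pos (s := ((n : ℝ) - 2) / 2) (by linarith)
  have := Real.Gamma_pos_of_pos (s := ((n : ℝ) - 1) / 2) (by linarith)
  have := Real.Gamma_pos_of_pos (s := (n : ℝ) / 2) (by linarith)
  have Gamma_half : Real.Gamma ((n : ℝ) / 2) =
      ((n : ℝ) - 2) / 2 * Real.Gamma (((n : ℝ) - 2) / 2) := by
    rw [← Real.Gamma_add_one (by linarith)]; congr 1; ring
  rw [← sq_eq_sq₀ (sphereNorm_nonneg (by lia) 0) (by positivity), sphereNorm_sq hn]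
  simp only [Nat.cast_zero, mul_zero, zero_add, Nat.factorial_zero, Nat.cast_one, mul_one]
  rw [Gamma_natCast_sub_two, Gamma_half]
  field_simp
  ring

lemma sphereConst_zero {n : ℕ} (hn : 2 ≤ n) : sphereConst n 0 = 1 := by
  rcases hn.eq_or_lt with rfl | hn
  · simp [sphereConst_two]
  · have : (3 : ℝ) ≤ n := mod_cast hn
    have := Real.Gamma_pos_of_pos (s := ((n : ℝ) - 1) / 2) (by linarith)
    have := Real.Gamma_pos_of_pos (s := (n : ℝ) / 2) (by linarith)
    have := Real.Gamma_pos_of_pos (s := (n : ℝ) - 2) (by linarith)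
    rw [sphereConst_of_three_le hn, sphereNorm_zero hn]
    simp only [Nat.cast_zero, zero_add, pow_zero, Nat.factorial_zero, Nat.cast_one, mul_one]
    field_simp

lemma sphereConst_nonneg {n : ℕ} (hn : 2 ≤ n) (l : ℕ) : 0 ≤ sphereConst n l := by
  rcases hn.eq_or_lt with rfl | hn
  · rw [sphereConst_two]
    positivity
  · have : (3 : ℝ) ≤ n := mod_cast hn
    have : (0 : ℝ) ≤ l := Nat.cast_nonneg _
    have := sphereNorm_nonneg (show 2 ≤ n by lia) l
    have := Real.Gamma_pos_of_pos (s := ((n : ℝ) - 1) / 2) (by linarith)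
    have := Real.Gamma_pos_of_pos (s := (n : ℝ) - 2) (by linarith)
    have := Real.Gamma_pos_of_pos (s := (l : ℝ) + n - 2) (by linarith)
    rw [sphereConst_of_three_le hn]
    positivity

lemma normRatio_nonneg {n : ℕ} (hn : 2 ≤ n) (l : ℕ) : 0 ≤ normRatio n l := by
  have : (2 : ℝ) ≤ n := mod_cast hn
  have : (0 : ℝ) ≤ l := Nat.cast_nonneg _
  rw [normRatio]
  split_ifs
  · positivity
  · exact div_nonneg (by linarith) (by linarith)

lemma sphereConst_mul_two_pow_sq {n : ℕ} (hn : 2 ≤ n) (l : ℕ) :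
    (sphereConst n l * 2 ^ l) ^ 2 = 8 / 2 ^ n / Real.Gamma ((l : ℝ) + (n : ℝ) / 2) ^ 2 *
      (√Real.pi * Real.Gamma ((n : ℝ) / 2) / Real.Gamma (((n : ℝ) - 1) / 2)) *
      (Real.Gamma ((l : ℝ) + n - 1) / (l.factorial : ℝ)) * normRatio n l := by
  rcases hn.eq_or_lt with rfl | hn
  · rw [sphereConst_two, normRatio, if_pos rfl, Nat.cast_ofNat,
      show (l : ℝ) + 2 / 2 = l + 1 by norm_num, show (l : ℝ) + 2 - 1 = l + 1 by ring,
      Real.Gamma_nat_eq_factorial, show ((2 : ℝ) - 1) / 2 = 1 / 2 by norm_num,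
      Real.Gamma_one_half_eq, show (2 : ℝ) / 2 = 1 by norm_num, Real.Gamma_one]
    field_simp
    norm_num
  · have : (3 : ℝ) ≤ n := mod_cast hn
    have : (0 : ℝ) ≤ l := Nat.cast_nonneg _
    have := Real.Gamma_pos_of_pos (s := ((n : ℝ) - 2) / 2) (by linarith)
    have := Real.Gamma_pos_of_pos (s := ((n : ℝ) - 1) / 2) (by linarith)
    have := Real.Gamma_pos_of_pos (s := (l : ℝ) + n - 2) (by linarith)
    have : 0 < (l : ℝ) + n - 2 := by linarith
    have Gamma_succ : Real.Gamma ((l : ℝ) + n - 1) =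
        ((l : ℝ) + n - 2) * Real.Gamma ((l : ℝ) + n - 2) := by
      rw [← Real.Gamma_add_one (by linarith)]; congr 1; ring
    rw [mul_pow, sphereConst_of_three_le hn, mul_pow, sphereNorm_sq hn, Gamma_natCast_sub_two,
      Gamma_succ, normRatio, if_neg (by lia)]
    generalize Real.Gamma ((l : ℝ) + (n : ℝ) / 2) = Gamma_top
    generalize Real.Gamma ((n : ℝ) / 2) = Gamma_half
    field_simp
    ring

lemma sphereConst_mul_two_pow {n : ℕ} (hn : 2 ≤ n) (l : ℕ) :
    sphereConst n l * 2 ^ l =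
      2 ^ ((3 - (n : ℝ)) / 2) / Real.Gamma ((l : ℝ) + (n : ℝ) / 2) *
      √(√Real.pi * Real.Gamma ((n : ℝ) / 2) / Real.Gamma (((n : ℝ) - 1) / 2)) *
      √(Real.Gamma ((l : ℝ) + n - 1) / (l.factorial : ℝ)) * √(normRatio n l) := by
  have : (2 : ℝ) ≤ n := mod_cast hn
  have : (0 : ℝ) ≤ l := Nat.cast_nonneg _
  have := sphereConst_nonneg hn l
  have := Real.Gamma_pos_of_pos (s := (n : ℝ) / 2) (by linarith)
  have := Real.Gamma_pos_of_pos (s := ((n : ℝ) - 1) / 2) (by linarith)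
  have := Real.Gamma_pos_of_pos (s := (l : ℝ) + n - 1) (by linarith)
  have two_rpow_sq : ((2 : ℝ) ^ ((3 - (n : ℝ)) / 2)) ^ 2 = 8 / 2 ^ n := by
    rw [← Real.rpow_mul_natCast (by norm_num), Nat.cast_ofNat, div_mul_cancel₀ _ two_ne_zero,
      Real.rpow_sub (by norm_num), Real.rpow_natCast]
    norm_num
  rw [← sq_eq_sq₀ (by positivity) (by positivity), sphereConst_mul_two_pow_sq hn, mul_pow _ √_,
    mul_pow _ √_, mul_pow _ √_, Real.sq_sqrt (normRatio_nonneg hn l), Real.sq_sqrt (by positivity),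
    Real.sq_sqrt (by positivity), div_pow, two_rpow_sq]

lemma A1_mul_A2 {p q : ℕ} (hp : 2 ≤ p) (hq : 2 ≤ q) (ν : ℕ) (σ : ℂ) (r s : ℕ) :
    A1 p q ν σ r s * A2 p q ν r s = poch (-σ / 2) (s + r + ν) *
      ((4 ^ s * sphereConst p (ν + 2 * s) *
        (sphereConst q (ν + 2 * r) * 2 ^ (ν + 2 * r)) : ℝ) : ℂ) := by
  have : (2 : ℝ) ≤ p := mod_cast hp
  have : (2 : ℝ) ≤ q := mod_cast hq
  have := Real.Gamma_pos_of_pos (s := (p : ℝ) / 2) (by linarith)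
  have := Real.Gamma_pos_of_pos (s := ((p : ℝ) - 1) / 2) (by linarith)
  have : 0 < Real.Gamma (2 * (s : ℝ) + ν + p - 1) := Real.Gamma_pos_of_pos (by
    linarith [show (0 : ℝ) ≤ 2 * s + ν by positivity])
  have four_pow_mul : 4 ^ s * sphereConst p (ν + 2 * s) =
      sphereConst p (ν + 2 * s) * 2 ^ (ν + 2 * s) / 2 ^ ν := by
    rw [pow_add, pow_mul, mul_div_assoc, mul_div_cancel_left₀ _ (by positivity), mul_comm]
    norm_num
  have two_rpow_split : (2 : ℝ) ^ (3 - ((p : ℝ) + q) / 2 - ν) =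
      2 ^ ((3 - (p : ℝ)) / 2) * 2 ^ ((3 - (q : ℝ)) / 2) / 2 ^ ν := by
    rw [Real.rpow_sub (by norm_num), Real.rpow_natCast, ← Real.rpow_add (by norm_num)]
    congr 2
    ring
  have pi_split : Real.pi * Real.Gamma ((p : ℝ) / 2) * Real.Gamma ((q : ℝ) / 2) =
      (√Real.pi * Real.Gamma ((p : ℝ) / 2)) * (√Real.pi * Real.Gamma ((q : ℝ) / 2)) := by
    rw [mul_mul_mul_comm, Real.mul_self_sqrt Real.pi_pos.le, mul_assoc]
  rw [A1, A2, mul_assoc, ← Complex.ofReal_mul, two_rpow_split, pi_split, ← div_mul_div_comm,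
    ← div_mul_div_comm, Real.sqrt_mul (by positivity), Real.sqrt_mul (by positivity),
    Real.sqrt_mul (normRatio_nonneg hp _)]
  congr 2
  rw [four_pow_mul, sphereConst_mul_two_pow hp, sphereConst_mul_two_pow hq]
  push_cast
  ring_nf

end Normalization

section AssociatedFunctions

/-- The moments of the normalized degree `l` basis function on the unit sphere of `ℝ^n`, as a
function of the first coordinate `cos φ` (for `n = 2`) or `x` (for `n ≥ 3`). -/
def sphereMoment (n l : ℕ) : ℕ → ℂ :=
  if n = 2 then
    moment 0 (2 * Real.pi) Real.cos fun φ => sphereNorm 2 l * Complex.exp (-Complex.I * l * φ)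
  else
    moment (-1) 1 id fun x =>
      sphereNorm n l * ((gegenbauer l (((n : ℝ) - 2) / 2) x : ℂ) * (weight n x : ℂ))

lemma moment_const_mul (a b : ℝ) (X : ℝ → ℝ) (W : ℝ → ℂ) (c : ℂ) :
    moment a b X (fun θ => c * W θ) = fun k => c * moment a b X W k := by
  funext k
  simp only [moment, mul_left_comm _ c, intervalIntegral.integral_const_mul]

lemma hasMoments_sphereMoment {n : ℕ} (hn : 2 ≤ n) (l : ℕ) :
    HasMoments (sphereMoment n l) (sphereConst n l) ((l : ℂ) + (n : ℂ) / 2) l := by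
  rcases hn.eq_or_lt with rfl | hn
  · rw [sphereMoment, sphereConst, if_pos rfl, if_pos rfl, moment_const_mul]
    push_cast
    exact (hasMoments_circle l).const_mul _
  · rw [sphereMoment, sphereConst, if_neg (by lia), if_neg (by lia), moment_const_mul]
    push_cast
    exact (hasMoments_gegenbauer hn l).const_mul _

lemma LamPow_comm (σ : ℂ) (α x y : ℝ) : LamPow σ α x y = LamPow σ α y x := by
  rw [LamPow, LamPow, Lam, Lam, add_comm (x ^ 2), mul_right_comm 2 x]

lemma continuous_circle_basis (c : ℂ) (l : ℕ) :
    Continuous fun φ : ℝ => c * Complex.exp (-Complex.I * l * φ) := by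
  fun_prop

lemma continuous_gegenbauer_basis {n : ℕ} (hn : 3 ≤ n) (c : ℂ) (l : ℕ) :
    Continuous fun x => c * ((gegenbauer l (((n : ℝ) - 2) / 2) x : ℂ) * (weight n x : ℂ)) := by
  have : (3 : ℝ) ≤ n := mod_cast hn
  have : Continuous (weight n) := continuous_one_sub_sq_rpow (by linarith)
  have := continuous_gegenbauer l (((n : ℝ) - 2) / 2)
  fun_prop

lemma cos_sq_le_one_of_mem_uIcc {a b : ℝ} : ∀ φ ∈ Set.uIcc a b, Real.cos φ ^ 2 ≤ 1 :=
  fun φ _ => Real.cos_sq_le_one φ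

lemma id_sq_le_one_of_mem_uIcc : ∀ x ∈ Set.uIcc (-1 : ℝ) 1, id x ^ 2 ≤ 1 := fun x hx => by
  rw [Set.uIcc_of_le (by norm_num)] at hx
  exact sq_le_one_iff_abs_le_one x |>.mpr (abs_le.mpr hx)

lemma hasSum_assocP_circle_circle (σ : ℂ) (lam mu : ℕ) (α : ℝ) :
    HasSum (fun n => momentCoeff (-σ / 2) (sphereMoment 2 mu) (sphereMoment 2 lam) n *
        (Real.tanh α : ℂ) ^ n) ((Real.cosh α : ℂ) * assocP 2 2 σ lam mu α) := by
  rw [sphereMoment, sphereMoment, if_pos rfl, if_pos rfl]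
  convert hasSum_integral_integral_LamPow Real.continuous_cos (continuous_circle_basis _ mu)
    cos_sq_le_one_of_mem_uIcc Real.continuous_cos (continuous_circle_basis _ lam)
    cos_sq_le_one_of_mem_uIcc σ α using 2
  rw [assocP, if_neg (by lia), if_neg (by lia), if_neg (by lia), sphereNorm, sphereNorm,
    if_pos rfl]
  simp only [← intervalIntegral.integral_const_mul]
  congr! 4 with _ φ
  rw [mul_add, Complex.exp_add]
  push_cast
  ring_nf

lemma hasSum_assocP_circle_sphere {q : ℕ} (hq : 3 ≤ q) (σ : ℂ) (lam mu : ℕ) (α : ℝ) :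
    HasSum (fun n => momentCoeff (-σ / 2) (sphereMoment 2 mu) (sphereMoment q lam) n *
        (Real.tanh α : ℂ) ^ n) ((Real.cosh α : ℂ) * assocP 2 q σ lam mu α) := by
  simp only [momentCoeff_symm _ (sphereMoment 2 mu)]
  rw [sphereMoment, sphereMoment, if_pos rfl, if_neg (by lia)]
  convert hasSum_integral_integral_LamPow continuous_id (continuous_gegenbauer_basis hq _ lam)
    id_sq_le_one_of_mem_uIcc Real.continuous_cos (continuous_circle_basis _ mu)
    cos_sq_le_one_of_mem_uIcc σ α using 2
  rw [assocP, if_neg (by lia), if_neg (by lia), if_pos hq, aOne_eq hq, sphereNorm, sphereNorm,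
    if_pos rfl]
  simp only [← intervalIntegral.integral_const_mul, LamPow_comm σ α (Real.cos _), id]
  congr! 4 with _ χ
  push_cast
  ring

lemma hasSum_assocP_sphere_circle {p : ℕ} (hp : 3 ≤ p) (σ : ℂ) (lam mu : ℕ) (α : ℝ) :
    HasSum (fun n => momentCoeff (-σ / 2) (sphereMoment p mu) (sphereMoment 2 lam) n *
        (Real.tanh α : ℂ) ^ n) ((Real.cosh α : ℂ) * assocP p 2 σ lam mu α) := by
  rw [sphereMoment, sphereMoment, if_pos rfl, if_neg (by lia)]
  convert hasSum_integral_integral_LamPow continuous_id (continuous_gegenbauer_basis hp _ mu)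
    id_sq_le_one_of_mem_uIcc Real.continuous_cos (continuous_circle_basis _ lam)
    cos_sq_le_one_of_mem_uIcc σ α using 2
  rw [assocP, if_neg (by lia), if_pos hp, aOne_eq hp, sphereNorm, sphereNorm, if_pos rfl]
  simp only [← intervalIntegral.integral_const_mul, id]
  congr! 4 with _ φ
  push_cast
  ring

lemma hasSum_assocP_sphere_sphere {p q : ℕ} (hp : 3 ≤ p) (hq : 3 ≤ q) (σ : ℂ) (lam mu : ℕ)
    (α : ℝ) :
    HasSum (fun n => momentCoeff (-σ / 2) (sphereMoment p mu) (sphereMoment q lam) n *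
        (Real.tanh α : ℂ) ^ n) ((Real.cosh α : ℂ) * assocP p q σ lam mu α) := by
  simp only [momentCoeff_symm _ (sphereMoment p mu)]
  rw [sphereMoment, sphereMoment, if_neg (by lia), if_neg (by lia)]
  convert hasSum_integral_integral_LamPow continuous_id (continuous_gegenbauer_basis hq _ lam)
    id_sq_le_one_of_mem_uIcc continuous_id (continuous_gegenbauer_basis hp _ mu)
    id_sq_le_one_of_mem_uIcc σ α using 2
  rw [assocP, if_pos ⟨hp, hq⟩, aTwo_eq hp hq]
  simp only [← intervalIntegral.integral_const_mul, id]
  congr! 4 with _ x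
  rw [LamPow_comm]
  push_cast
  ring

lemma hasSum_assocP {p q : ℕ} (hp : 2 ≤ p) (hq : 2 ≤ q) (σ : ℂ) (lam mu : ℕ) (α : ℝ) :
    HasSum (fun n => momentCoeff (-σ / 2) (sphereMoment p mu) (sphereMoment q lam) n *
        (Real.tanh α : ℂ) ^ n) ((Real.cosh α : ℂ) * assocP p q σ lam mu α) := by
  rcases hp.eq_or_lt with rfl | hp <;> rcases hq.eq_or_lt with rfl | hq
  · exact hasSum_assocP_circle_circle σ lam mu α
  · exact hasSum_assocP_circle_sphere hq σ lam mu α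
  · exact hasSum_assocP_sphere_circle hp σ lam mu α
  · exact hasSum_assocP_sphere_sphere hp hq σ lam mu α

lemma ofReal_cosh_ne_zero (α : ℝ) : (Real.cosh α : ℂ) ≠ 0 := mod_cast (Real.cosh_pos α).ne'

lemma assocFn_symm {p q : ℕ} (hp : 2 ≤ p) (hq : 2 ≤ q) (ν : ℕ) (σ : ℂ) (r s : ℕ) (α : ℝ) :
    assocFn p q ν σ r s α = assocFn q p ν σ s r α := by
  have sum_pq := hasSum_assocP hp hq σ (ν + 2 * r) (ν + 2 * s) α
  simp only [momentCoeff_symm _ (sphereMoment p _)] at sum_pq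
  exact mul_left_cancel₀ (ofReal_cosh_ne_zero α) (sum_pq.unique (hasSum_assocP hq hp σ _ _ α))

lemma cosh_mul_assocFn {p q ν r s : ℕ} (hp : 2 ≤ p) (hq : 2 ≤ q) (hν : ν ≤ 1) (hrs : r ≤ s)
    (σ : ℂ) (α : ℝ) :
    (Real.cosh α : ℂ) * assocFn p q ν σ r s α =
      prefactor p q ν σ r s * (Real.tanh α : ℂ) ^ (2 * s + ν) *
        hornSeries u5 (assocNum p q ν σ r s) v3 (assocDen p q ν r s) (tanhSq α) := by
  rw [assocFn, eq_hornSeries_of_hasSum hp (by lia) hν hrs (hasMoments_sphereMoment hp _)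
    (hasMoments_sphereMoment hq _) σ α (hasSum_assocP hp hq σ _ _ α), prefactor,
    mul_assoc _ (A1 ..), A1_mul_A2 hp hq]
  push_cast
  field

lemma assocFn_eq {p q ν r s : ℕ} (hp : 2 ≤ p) (hq : 2 ≤ q) (hν : ν ≤ 1) (hrs : r ≤ s)
    (σ : ℂ) (α : ℝ) :
    assocFn p q ν σ r s α =
      prefactor p q ν σ r s * ((Real.tanh α ^ (2 * s + ν) / Real.cosh α : ℝ) : ℂ) *
        hornSeries u5 (assocNum p q ν σ r s) v3 (assocDen p q ν r s) (tanhSq α) := by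
  refine mul_left_cancel₀ (ofReal_cosh_ne_zero α) ?_
  rw [cosh_mul_assocFn hp hq hν hrs, Complex.ofReal_div, Complex.ofReal_pow]
  have := ofReal_cosh_ne_zero α
  field

end AssociatedFunctions

section ZonalFunctions

lemma zonal_eq_assocFn {p q : ℕ} (hq : 2 ≤ q) (σ : ℂ) (α : ℝ) :
    zonal p q σ α = assocFn p q 0 σ 0 0 α := by
  have pi_pow : 2 * Real.pi ^ ((3 : ℝ) / 2) = √Real.pi * (2 * Real.pi) := by
    rw [pi_rpow_three_half, pow_succ, Real.sq_sqrt Real.pi_pos.le]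
    ring
  rw [zonal, assocFn, assocP, if_neg (by lia)]
  simp only [mul_zero, add_zero, gegenbauer_zero, Nat.cast_zero, zero_mul, Complex.exp_zero,
    Complex.ofReal_one, mul_one]
  split_ifs with both_ge hp_ge hq_ge
  · rw [aTwo_eq both_ge.1 both_ge.2, sphereNorm_zero both_ge.1, sphereNorm_zero both_ge.2,
      div_mul_div_comm, mul_mul_mul_comm √Real.pi, Real.mul_self_sqrt Real.pi_pos.le,
      ← mul_assoc Real.pi]
  · rw [aOne_eq hp_ge, sphereNorm_zero hp_ge, pi_pow, div_mul_div_comm, mul_one, mul_right_comm]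
  · rw [aOne_eq hq_ge, sphereNorm_zero hq_ge, pi_pow, div_mul_div_comm, mul_one, mul_right_comm]
  · rfl

lemma assocNum_zero (p q : ℕ) (σ : ℂ) : assocNum p q 0 σ 0 0 =
    ![1, 1 / 2, -σ / 2, ((q : ℂ) + σ) / 2, ((p : ℂ) + σ) / 2] := by
  simp [assocNum, neg_div]

lemma assocDen_zero (p q : ℕ) : assocDen p q 0 0 0 = ![(p : ℂ) / 2, (q : ℂ) / 2, 1] := by
  simp [assocDen]

lemma cpow_eq_LamPow_one (σ : ℂ) (α : ℝ) {x : ℝ} (hx : x ^ 2 ≤ 1) :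
    ((Real.cosh α - x * Real.sinh α : ℝ) : ℂ) ^ σ = LamPow σ α 1 x := by
  have cosh_sq := Real.cosh_sq α
  have base_pos : 0 < Real.cosh α - x * Real.sinh α := by
    have sq_lt : (x * Real.sinh α) ^ 2 < Real.cosh α ^ 2 := by
      rw [mul_pow]; nlinarith [sq_nonneg (Real.sinh α)]
    linarith [lt_of_pow_lt_pow_left₀ 2 (Real.cosh_pos α).le sq_lt]
  have Lam_one : Lam α 1 x = (Real.cosh α - x * Real.sinh α) * (Real.cosh α - x * Real.sinh α) := by
    rw [Lam]; linear_combination (-1) * cosh_sq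
  rw [LamPow, Lam_one, Complex.ofReal_mul, Complex.mul_cpow_ofReal_nonneg base_pos.le base_pos.le,
    ← Complex.cpow_add _ _ (mod_cast base_pos.ne'), add_halves]

lemma hasSum_zonal_one {p : ℕ} (hp : 2 ≤ p) (σ : ℂ) (α : ℝ) :
    HasSum (fun n => momentCoeff (-σ / 2) (fun k => ((1 : ℝ) : ℂ) ^ k) (sphereMoment p 0) n *
        (Real.tanh α : ℂ) ^ n) ((Real.cosh α : ℂ) * zonal p 1 σ α) := by
  rcases hp.eq_or_lt with rfl | hp
  · rw [sphereMoment, if_pos rfl]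
    convert hasSum_integral_LamPow Real.continuous_cos (continuous_circle_basis _ 0)
      cos_sq_le_one_of_mem_uIcc σ α (one_pow 2).le using 2
    rw [zonal, if_pos rfl, if_neg (by lia), sphereNorm, if_pos rfl,
      ← intervalIntegral.integral_const_mul]
    refine intervalIntegral.integral_congr fun χ _ => ?_
    rw [cpow_eq_LamPow_one σ α (Real.cos_sq_le_one χ)]
    simp [mul_comm]
  · rw [sphereMoment, if_neg (by lia)]
    convert hasSum_integral_LamPow continuous_id (continuous_gegenbauer_basis hp _ 0)
      id_sq_le_one_of_mem_uIcc σ α (one_pow 2).le using 2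
    rw [zonal, if_pos rfl, if_pos (by lia), sphereNorm_zero hp,
      ← intervalIntegral.integral_const_mul]
    refine intervalIntegral.integral_congr fun x hx => ?_
    simp only [id, gegenbauer_zero, Complex.ofReal_one, one_mul]
    rw [cpow_eq_LamPow_one σ α (x := x) (id_sq_le_one_of_mem_uIcc x hx), mul_left_comm]

lemma cosh_mul_zonal {p q : ℕ} (hp : 2 ≤ p) (hq : 1 ≤ q) (σ : ℂ) (α : ℝ) :
    (Real.cosh α : ℂ) * zonal p q σ α =
      hornSeries u5 (assocNum p q 0 σ 0 0) v3 (assocDen p q 0 0 0) (tanhSq α) := by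
  have sphere_moments := hasMoments_sphereMoment hp 0
  rcases hq.eq_or_lt with rfl | hq
  · have momentCoeff_point (n : ℕ) : momentCoeff (-σ / 2) (fun k => ((1 : ℝ) : ℂ) ^ k)
        (sphereMoment p 0) n = momentCoeff (-σ / 2) (sphereMoment p 0)
          (fun k => if Even k then 1 else 0) n := by
      rw [momentCoeff_even_part _ _ sphere_moments, momentCoeff_symm]
      simp only [Complex.ofReal_one, one_pow]
    have sum_zonal := hasSum_zonal_one hp σ α
    simp only [momentCoeff_point] at sum_zonal
    rw [eq_hornSeries_of_hasSum (ν := 0) (r := 0) (s := 0) hp le_rfl zero_le_one le_rfl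
      sphere_moments hasMoments_point σ α sum_zonal]
    simp [sphereConst_zero hp, poch_zero]
  · rw [zonal_eq_assocFn hq, assocFn, eq_hornSeries_of_hasSum (ν := 0) (r := 0) (s := 0) hp
      (by lia) zero_le_one le_rfl sphere_moments (hasMoments_sphereMoment hq 0) σ α
      (hasSum_assocP hp hq σ 0 0 α)]
    simp [sphereConst_zero hp, sphereConst_zero hq, poch_zero]

end ZonalFunctions

end

end SOpq

theorem mainTheorem2 :
    -- the explicit formula for `s ≥ r`, with absolute convergence of the double series
    (∀ (p q ν r s : ℕ) (σ : ℂ) (α : ℝ), 2 ≤ p → 2 ≤ q → ν ≤ 1 → r ≤ s →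
      Summable (hornTerm u5 (assocNum p q ν σ r s) v3 (assocDen p q ν r s) (tanhSq α)) ∧
      assocFn p q ν σ r s α =
        prefactor p q ν σ r s * ((Real.tanh α ^ (2 * s + ν) / Real.cosh α : ℝ) : ℂ) *
          hornSeries u5 (assocNum p q ν σ r s) v3 (assocDen p q ν r s) (tanhSq α)) ∧
    -- the symmetry
    (∀ (p q ν r s : ℕ) (σ : ℂ) (α : ℝ), 2 ≤ p → 2 ≤ q → ν ≤ 1 →
      assocFn p q ν σ r s α = assocFn q p ν σ s r α) ∧
    -- the explicit formula for `s ≤ r`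
    (∀ (p q ν r s : ℕ) (σ : ℂ) (α : ℝ), 2 ≤ p → 2 ≤ q → ν ≤ 1 → s ≤ r →
      Summable (hornTerm u5 (assocNum q p ν σ s r) v3 (assocDen q p ν s r) (tanhSq α)) ∧
      assocFn p q ν σ r s α =
        prefactor q p ν σ s r * ((Real.tanh α ^ (2 * r + ν) / Real.cosh α : ℝ) : ℂ) *
          hornSeries u5 (assocNum q p ν σ s r) v3 (assocDen q p ν s r) (tanhSq α)) ∧
    -- the zonal function is the case `r = s = ν = 0`
    (∀ (p q : ℕ) (σ : ℂ) (α : ℝ), 2 ≤ p → 2 ≤ q →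
      zonal p q σ α = assocFn p q 0 σ 0 0 α) ∧
    -- the zonal formula
    (∀ (p q : ℕ) (σ : ℂ) (α : ℝ), 2 ≤ p → 1 ≤ q →
      Summable (hornTerm u5
        ![1, 1 / 2, -σ / 2, ((q : ℂ) + σ) / 2, ((p : ℂ) + σ) / 2]
        v3 ![(p : ℂ) / 2, (q : ℂ) / 2, 1] (tanhSq α)) ∧
      zonal p q σ α = ((1 / Real.cosh α : ℝ) : ℂ) *
        hornSeries u5
          ![1, 1 / 2, -σ / 2, ((q : ℂ) + σ) / 2, ((p : ℂ) + σ) / 2]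
          v3 ![(p : ℂ) / 2, (q : ℂ) / 2, 1] (tanhSq α)) := by
  refine ⟨fun p q ν r s σ α hp hq hν hrs => ⟨summable_hornTerm hp (by lia) ν σ hrs α,
      assocFn_eq hp hq hν hrs σ α⟩, fun p q ν r s σ α hp hq _ => assocFn_symm hp hq ν σ r s α,
    fun p q ν r s σ α hp hq hν hrs => ⟨summable_hornTerm hq (by lia) ν σ hrs α, ?_⟩,
    fun p q σ α _ hq => zonal_eq_assocFn hq σ α, fun p q σ α hp hq => ?_⟩
  · rw [assocFn_symm hp hq, assocFn_eq hq hp hν hrs]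
  · rw [← assocNum_zero, ← assocDen_zero]
    refine ⟨summable_hornTerm hp hq 0 σ le_rfl α, ?_⟩
    rw [← cosh_mul_zonal hp hq, Complex.ofReal_div, Complex.ofReal_one, ← mul_assoc,
      one_div_mul_cancel (ofReal_cosh_ne_zero α), one_mul]
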